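/- Let $K$ be a compact (Hausdorff) group acting continuously and orthogonally on $\mathbb R^n$, and let $\rho_1,\dots,\rho_\ell$ be non-constant real polynomials generating the algebra $\mathcal P(\mathbb R^n)^K$ of $K$-invariant real polynomials on $\mathbb R^n$; put $\rho=(\rho_1,\dots,\rho_\ell):\mathbb R^n\to\mathbb R^\ell$. With $dk$ the normalized Haar measure of $K$ and $dx$, $d\xi$ the Lebesgue measure on $\mathbb R^n$, put $$\varphi_\xi(x)=\int_K e^{i\langle x,k\cdot\xi\rangle}\,dk,\qquad \mathcal F(g)(\varphi_\xi)=\int_{\mathbb R^n}g(x)\,\varphi_\xi(-x)\,dx,\qquad \widehat g(\xi)=\int_{\mathbb R^n}g(x)\,e^{-i\langle x,\xi\rangle}\,dx .$$ Let $p_{m,\xi}$ be the homogeneous component of degree $m$ of the Taylor expansion of $\varphi_\xi$ at $0$. An *expansion of the spherical functions in the generators* is a family of polynomials $q_{m,J}\in\mathbb C[s_1,\dots,s_\ell]$ ($m\in\mathbb N$, $J\in\mathbb N^\ell$), with only finitely many $q_{m,J}\ne0$ for each $m$, such that * $p_{m,\xi}(x)=\sum_J q_{m,J}(\rho(\xi))\,\rho(x)^J$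 for all $m$ and all $x,\xi\in\mathbb R^n$, where $\rho(x)^J=\prod_k\rho_k(x)^{j_k}$; * if all $\rho_k$ are homogeneous, then $q_{m,J}\neq 0$ only if $\sum_k j_k\deg\rho_k=m$ (so that $J$ determines $m$, and one may write $q_J$); * the series $\sum_{m,J}q_{m,J}(\rho(\xi))\,\rho(x)^J$ converges absolutely, uniformly for $x$ in compact sets for each fixed $\xi$, and uniformly for $\xi$ in compact sets for each fixed $x$. Then such an expansion exists. Moreover, for every such expansion: 1. For every $\xi\in\mathbb R^n$ the series $h_\xi(t)=\sum_{m,J}q_{m,J}(\rho(\xi))\,t^J$ converges absolutely for all $t\in\mathbb R^\ell$, the function $h_\xi:\mathbb R^\ell\to\mathbb C$ is real analytic, and $\varphi_\xi(x)=h_\xi(\rho(x))$ for all $x\in\mathbb R^n$. 2. For every compactly supported $K$-invariant $g\in C^\infty(\mathbb R^n)$ (complex-valued), the integral $$h(t)=\int_{\mathbb R^n}g(-\xi)\,h_\xi(t)\,d\xi$$ converges absolutely for every $t\in\mathbb R^\ell$, the function $h$ belongs to $C^\infty(\mathbb R^\ell)$ and is real analytic on $\mathbb R^\ell$, and for all $\xi\in\mathbb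 R^n$ $$\mathcal F(g)(\varphi_\xi)=\widehat g(\xi)=h(\rho(\xi)).$$ -/

import Mathlib

open MeasureTheory
open scoped ContDiff

noncomputable section

/-- The algebra `𝒫(ℝⁿ)ᴷ` of real polynomials on `ℝⁿ` that are invariant under the orthogonal
action `π` of the group `K`. -/
def invariantPolynomials {n : ℕ} {K : Type*} [Group K]
    (π : K →* (EuclideanSpace ℝ (Fin n) ≃ₗᵢ[ℝ] EuclideanSpace ℝ (Fin n))) :
    Subalgebra ℝ (MvPolynomial (Fin n) ℝ) where
  carrier := {p | ∀ (k : K) (x : EuclideanSpace ℝ (Fin n)),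
    MvPolynomial.eval (fun i => π k x i) p = MvPolynomial.eval (fun i => x i) p}
  mul_mem' := by
    intro p q hp hq k x
    rw [map_mul, map_mul, hp k x, hq k x]
  add_mem' := by
    intro p q hp hq k x
    rw [map_add, map_add, hp k x, hq k x]
  algebraMap_mem' := by
    intro r k x
    simp [MvPolynomial.algebraMap_eq]

/-- The map `ρ = (ρ₁, …, ρ_ℓ) : ℝⁿ → ℝ^ℓ` given by polynomials `ρ₁, …, ρ_ℓ`. -/
def polyMap {n ℓ : ℕ} (ρ : Fin ℓ → MvPolynomial (Fin n) ℝ) (x : EuclideanSpace ℝ (Fin n)) :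
    Fin ℓ → ℝ :=
  fun j => MvPolynomial.eval (fun i => x i) (ρ j)

/-- The spherical function `φ_ξ(x) = ∫_K exp(i⟨x, k·ξ⟩) dk`, where `dk` is the Haar measure of the
compact group `K` with total mass `1`. -/
def sphericalFunction {n : ℕ} {K : Type*} [Group K] [TopologicalSpace K] [IsTopologicalGroup K]
    [CompactSpace K] [MeasurableSpace K] [BorelSpace K]
    (π : K →* (EuclideanSpace ℝ (Fin n) ≃ₗᵢ[ℝ] EuclideanSpace ℝ (Fin n)))
    (ξ x : EuclideanSpace ℝ (Fin n)) : ℂ :=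
  ∫ k : K, Complex.exp (Complex.I * ((inner ℝ x (π k ξ) : ℝ) : ℂ)) ∂(Measure.haarMeasure ⊤)

/-- The Gelfand transform `𝓕(f)(φ) = ∫ f(x) φ(-x) dx` at a spherical function `φ`. -/
def gelfandTransform {n : ℕ} (f φ : EuclideanSpace ℝ (Fin n) → ℂ) : ℂ :=
  ∫ x, f x * φ (-x)

/-- The classical Fourier transform `∫ f(x) exp(-i⟨x, ξ⟩) dx`. -/
def classicalFourier {n : ℕ} (f : EuclideanSpace ℝ (Fin n) → ℂ)
    (ξ : EuclideanSpace ℝ (Fin n)) : ℂ :=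
  ∫ x, f x * Complex.exp (-Complex.I * ((inner ℝ x ξ : ℝ) : ℂ))

/-- The homogeneous component of degree `m` of the Taylor expansion of `f` at the origin, as a
function of `x`: it is `(1 / m!) (d/ds)ᵐ f(s x)` at `s = 0`. -/
def taylorComponent {n : ℕ} (f : EuclideanSpace ℝ (Fin n) → ℂ) (m : ℕ)
    (x : EuclideanSpace ℝ (Fin n)) : ℂ :=
  ((m.factorial : ℂ))⁻¹ * iteratedDeriv m (fun s : ℝ => f (s • x)) 0

/-- The monomial `t^J = t₁^{j₁} ⋯ t_ℓ^{j_ℓ}` at a real point, as a complex number. -/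
def monomialAt {ℓ : ℕ} (J : Fin ℓ →₀ ℕ) (t : Fin ℓ → ℝ) : ℂ :=
  ∏ j, ((t j : ℝ) : ℂ) ^ J j

/-- The value `q(s)` of a complex polynomial at a real point `s`. -/
def evalReal {ℓ : ℕ} (q : MvPolynomial (Fin ℓ) ℂ) (s : Fin ℓ → ℝ) : ℂ :=
  MvPolynomial.eval (fun j => ((s j : ℝ) : ℂ)) q

/-- `q` is a choice of coefficients in the expansion
`φ_ξ(x) = ∑ₘ ∑_J q_{m,J}(ρ(ξ)) ρ(x)^J` of the spherical functions in the generators `ρ`.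
For homogeneous `ρ` only exponents `J` with `∑ⱼ Jⱼ deg ρⱼ = m` occur, so that `J` determines `m`
and `q_{m,J}` is a single polynomial `q_J`. -/
structure IsSphericalExpansion {n ℓ : ℕ} {K : Type*} [Group K] [TopologicalSpace K]
    [IsTopologicalGroup K] [CompactSpace K] [MeasurableSpace K] [BorelSpace K]
    (π : K →* (EuclideanSpace ℝ (Fin n) ≃ₗᵢ[ℝ] EuclideanSpace ℝ (Fin n)))
    (ρ : Fin ℓ → MvPolynomial (Fin n) ℝ)
    (q : ℕ → (Fin ℓ →₀ ℕ) →₀ MvPolynomial (Fin ℓ) ℂ) : Prop where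
  /-- `∑_J q_{m,J}(ρ(ξ)) ρ(x)^J` is the Taylor component of degree `m` of `φ_ξ`. -/
  taylor_eq : ∀ (m : ℕ) (ξ x : EuclideanSpace ℝ (Fin n)),
    taylorComponent (sphericalFunction π ξ) m x =
      (q m).sum fun J c => evalReal c (polyMap ρ ξ) * monomialAt J (polyMap ρ x)
  /-- Degrees match when the generators are homogeneous. -/
  weight_eq : (∀ j, (ρ j).IsHomogeneous (ρ j).totalDegree) →
    ∀ (m : ℕ), ∀ J ∈ (q m).support, ∑ j, J j * (ρ j).totalDegree = m
  /-- For fixed `ξ`, absolute convergence, uniformly for `x` in compact sets. -/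
  summable_left : ∀ ξ : EuclideanSpace ℝ (Fin n),
    SummableLocallyUniformlyOn
      (fun (p : ℕ × (Fin ℓ →₀ ℕ)) (x : EuclideanSpace ℝ (Fin n)) =>
        ‖evalReal (q p.1 p.2) (polyMap ρ ξ) * monomialAt p.2 (polyMap ρ x)‖) Set.univ
  /-- For fixed `x`, absolute convergence, uniformly for `ξ` in compact sets. -/
  summable_right : ∀ x : EuclideanSpace ℝ (Fin n),
    SummableLocallyUniformlyOn
      (fun (p : ℕ × (Fin ℓ →₀ ℕ)) (ξ : EuclideanSpace ℝ (Fin n)) =>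
        ‖evalReal (q p.1 p.2) (polyMap ρ ξ) * monomialAt p.2 (polyMap ρ x)‖) Set.univ

/-- The function `h_ξ(t) = ∑ₘ ∑_J q_{m,J}(ρ(ξ)) t^J` on `ℝ^ℓ`. -/
def hXi {n ℓ : ℕ} (ρ : Fin ℓ → MvPolynomial (Fin n) ℝ)
    (q : ℕ → (Fin ℓ →₀ ℕ) →₀ MvPolynomial (Fin ℓ) ℂ)
    (ξ : EuclideanSpace ℝ (Fin n)) (t : Fin ℓ → ℝ) : ℂ :=
  ∑' p : ℕ × (Fin ℓ →₀ ℕ), evalReal (q p.1 p.2) (polyMap ρ ξ) * monomialAt p.2 t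

/-- The function `h(t) = ∫ g(-ξ) h_ξ(t) dξ` on `ℝ^ℓ`. -/
def hExt {n ℓ : ℕ} (ρ : Fin ℓ → MvPolynomial (Fin n) ℝ)
    (q : ℕ → (Fin ℓ →₀ ℕ) →₀ MvPolynomial (Fin ℓ) ℂ)
    (g : EuclideanSpace ℝ (Fin n) → ℂ) (t : Fin ℓ → ℝ) : ℂ :=
  ∫ ξ, g (-ξ) * hXi ρ q ξ t

end

/-! Existence. The degree `m` Taylor component of `φ_ξ` is `(i^m / m!) ∫ ⟨x, kξ⟩^m dk`. Replacing
`x` by `hx` and averaging over `h` as well, the multinomial theorem turns it into `i^m ∑_{|α|=m}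
A_α(x) A_α(ξ) / α!`, where `A_α` is the `K`-average of the monomial `X^α`. Each `A_α` is an
invariant polynomial, hence `A_α = F_α(ρ)`, and expanding `F_α(ρ(x))` in monomials gives the
`q_{m,J}`. Convergence needs lifts with `‖F_α‖_R ≤ D^{|α|}` for every `R`, where `‖·‖_R` is the `ℓ¹`
norm of the coefficients with all weights `R`; then the factor `1/α!` wins.

Such lifts come from elimination. Let `I` be the kernel of `ℝ[x,t] → ℝ[x]`, `t_j ↦ ρ_j`. For the
lexicographic order with the `x_i` above the `t_j`, the normal form modulo `I` of a polynomial in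
`ℝ[ρ]` involves only `t`, and it is a lift. Reduction does not increase a weighted norm whose
weights make every leading term of the Gröbner basis dominate its tail, and such weights exist above
any bound (`exists_lift_weightedNorm_le`). No linearity of the lift is needed.

Arbitrary expansions. Since no `ρ_j` is constant, some line in `ℝⁿ` makes all `|ρ_j|` tend to
infinity, so every `t` is dominated coordinatewise by some `ρ(x)`. Absolute convergence at `ρ(x)`
then gives it at `t`, and a power series converging absolutely everywhere is analytic
(`analyticOnNhd_tsum_monomialAt`). The sum of absolute values at `ρ(x)` is continuous in `ξ`, so
integration against `g` may be done term by term, which makes `h` another everywhere convergent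
power series. The Fourier identities are Fubini and the invariance of `g` and of Lebesgue measure
under `K`. -/

/-- The value `w^α` of a monomial at a real point. -/
noncomputable def monomialWeight {σ : Type*} (w : σ → ℝ) (α : σ →₀ ℕ) : ℝ :=
  α.prod fun i k => w i ^ k

/-- The weighted `ℓ¹` norm `∑ |c_α| w^α` of a polynomial `∑ c_α X^α`. -/
noncomputable def weightedNorm {σ : Type*} (w : σ → ℝ) (p : MvPolynomial σ ℝ) : ℝ :=
  ∑ α ∈ p.support, |p.coeff α| * monomialWeight w α

/-! ### Weighted `ℓ¹` norms of polynomials -/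

section weightedNorm

variable {σ : Type*} {w : σ → ℝ}

lemma monomialWeight_zero : monomialWeight w 0 = 1 := by simp [monomialWeight]

lemma monomialWeight_add (α β : σ →₀ ℕ) :
    monomialWeight w (α + β) = monomialWeight w α * monomialWeight w β := by
  classical
  exact Finsupp.prod_add_index' (by simp) (by simp [pow_add])

lemma monomialWeight_nonneg (hw : ∀ i, 0 ≤ w i) (α : σ →₀ ℕ) : 0 ≤ monomialWeight w α :=
  Finset.prod_nonneg fun i _ => pow_nonneg (hw i) _

lemma monomialWeight_mono {w' : σ → ℝ} (hw : ∀ i, 0 ≤ w i) (h : ∀ i, w i ≤ w' i) (α : σ →₀ ℕ) :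
    monomialWeight w α ≤ monomialWeight w' α :=
  Finset.prod_le_prod (fun i _ => pow_nonneg (hw i) _)
    fun i _ => pow_le_pow_left₀ (hw i) (h i) _

lemma monomialWeight_const (c : ℝ) (α : σ →₀ ℕ) :
    monomialWeight (fun _ => c) α = c ^ α.degree := by
  simp [monomialWeight, Finsupp.prod, Finset.prod_pow_eq_pow_sum, Finsupp.degree_apply]

lemma weightedNorm_eq_sum (p : MvPolynomial σ ℝ) {s : Finset (σ →₀ ℕ)} (hs : p.support ⊆ s) :
    weightedNorm w p = ∑ α ∈ s, |p.coeff α| * monomialWeight w α := by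
  refine Finset.sum_subset hs fun α _ h => ?_
  simp [MvPolynomial.notMem_support_iff.mp h]

lemma weightedNorm_zero : weightedNorm w 0 = 0 := by simp [weightedNorm]

lemma weightedNorm_nonneg (hw : ∀ i, 0 ≤ w i) (p : MvPolynomial σ ℝ) : 0 ≤ weightedNorm w p :=
  Finset.sum_nonneg fun α _ => mul_nonneg (abs_nonneg _) (monomialWeight_nonneg hw α)

lemma weightedNorm_monomial (α : σ →₀ ℕ) (c : ℝ) :
    weightedNorm w (MvPolynomial.monomial α c) = |c| * monomialWeight w α := by
  classical
  rw [weightedNorm_eq_sum _ (MvPolynomial.support_monomial_subset (s := α) (a := c))]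
  simp

lemma weightedNorm_add_le (hw : ∀ i, 0 ≤ w i) (p q : MvPolynomial σ ℝ) :
    weightedNorm w (p + q) ≤ weightedNorm w p + weightedNorm w q := by
  classical
  rw [weightedNorm_eq_sum _ (MvPolynomial.support_add (p := p) (q := q)),
    weightedNorm_eq_sum p (Finset.subset_union_left (s₂ := q.support)),
    weightedNorm_eq_sum q (Finset.subset_union_right (s₁ := p.support)), ← Finset.sum_add_distrib]
  refine Finset.sum_le_sum fun α _ => ?_
  rw [← add_mul, MvPolynomial.coeff_add]
  exact mul_le_mul_of_nonneg_right (abs_add_le _ _) (monomialWeight_nonneg hw α)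

lemma weightedNorm_sum_le (hw : ∀ i, 0 ≤ w i) {ι : Type*} (s : Finset ι)
    (f : ι → MvPolynomial σ ℝ) :
    weightedNorm w (∑ i ∈ s, f i) ≤ ∑ i ∈ s, weightedNorm w (f i) :=
  Finset.le_sum_of_subadditive (weightedNorm w) weightedNorm_zero.le (weightedNorm_add_le hw) s f

lemma weightedNorm_C_mul (c : ℝ) (p : MvPolynomial σ ℝ) :
    weightedNorm w (MvPolynomial.C c * p) = |c| * weightedNorm w p := by
  classical
  have hs : (MvPolynomial.C c * p).support ⊆ p.support := by
    intro α
    simp only [MvPolynomial.mem_support_iff, MvPolynomial.coeff_C_mul]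
    exact right_ne_zero_of_mul
  rw [weightedNorm_eq_sum _ hs, weightedNorm, Finset.mul_sum]
  exact Finset.sum_congr rfl fun α _ => by rw [MvPolynomial.coeff_C_mul, abs_mul, mul_assoc]

lemma weightedNorm_mul_le (hw : ∀ i, 0 ≤ w i) (p q : MvPolynomial σ ℝ) :
    weightedNorm w (p * q) ≤ weightedNorm w p * weightedNorm w q := by
  classical
  have h : p * q = ∑ α ∈ p.support, ∑ β ∈ q.support,
      MvPolynomial.monomial (α + β) (p.coeff α * q.coeff β) := by
    conv_lhs => rw [p.as_sum, q.as_sum, Finset.sum_mul_sum]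
    simp [MvPolynomial.monomial_mul]
  rw [h]
  refine (weightedNorm_sum_le hw _ _).trans ?_
  rw [weightedNorm, weightedNorm, Finset.sum_mul_sum]
  refine Finset.sum_le_sum fun α _ => (weightedNorm_sum_le hw _ _).trans
    (Finset.sum_le_sum fun β _ => le_of_eq ?_)
  rw [weightedNorm_monomial, monomialWeight_add, abs_mul]
  ring

lemma weightedNorm_one : weightedNorm w 1 = 1 := by
  simpa [monomialWeight_zero] using weightedNorm_monomial (w := w) 0 1

lemma weightedNorm_pow_le (hw : ∀ i, 0 ≤ w i) (p : MvPolynomial σ ℝ) (k : ℕ) :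
    weightedNorm w (p ^ k) ≤ weightedNorm w p ^ k := by
  induction k with
  | zero => simp [weightedNorm_one]
  | succ k ih =>
    rw [pow_succ, pow_succ]
    exact (weightedNorm_mul_le hw _ _).trans
      (mul_le_mul_of_nonneg_right ih (weightedNorm_nonneg hw p))

lemma weightedNorm_prod_le (hw : ∀ i, 0 ≤ w i) {ι : Type*} (s : Finset ι)
    (f : ι → MvPolynomial σ ℝ) :
    weightedNorm w (∏ i ∈ s, f i) ≤ ∏ i ∈ s, weightedNorm w (f i) := by
  classical
  induction s using Finset.induction_on with
  | empty => simp [weightedNorm_one]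
  | insert i s hi ih =>
    rw [Finset.prod_insert hi, Finset.prod_insert hi]
    exact (weightedNorm_mul_le hw _ _).trans
      (mul_le_mul_of_nonneg_left ih (weightedNorm_nonneg hw _))

lemma weightedNorm_mono {w' : σ → ℝ} (hw : ∀ i, 0 ≤ w i) (h : ∀ i, w i ≤ w' i)
    (p : MvPolynomial σ ℝ) : weightedNorm w p ≤ weightedNorm w' p :=
  Finset.sum_le_sum fun α _ =>
    mul_le_mul_of_nonneg_left (monomialWeight_mono hw h α) (abs_nonneg _)

lemma weightedNorm_rename {τ : Type*} {f : σ → τ} (hf : Function.Injective f) (w : τ → ℝ)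
    (p : MvPolynomial σ ℝ) :
    weightedNorm w (MvPolynomial.rename f p) = weightedNorm (w ∘ f) p := by
  classical
  rw [weightedNorm, MvPolynomial.support_rename_of_injective hf,
    Finset.sum_image fun α _ β _ h => Finsupp.mapDomain_injective hf h]
  refine Finset.sum_congr rfl fun α _ => ?_
  rw [MvPolynomial.coeff_rename_mapDomain f hf, monomialWeight, monomialWeight,
    Finsupp.prod_mapDomain_index_inj hf]
  rfl

lemma weightedNorm_le_of_coeff (hw : ∀ i, 0 ≤ w i) {p q : MvPolynomial σ ℝ}
    (h : ∀ α ∈ p.support, p.coeff α = q.coeff α) : weightedNorm w p ≤ weightedNorm w q := by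
  have hs : p.support ⊆ q.support := fun α hα => by
    rw [MvPolynomial.mem_support_iff, ← h α hα]
    exact MvPolynomial.mem_support_iff.mp hα
  rw [weightedNorm, weightedNorm]
  refine le_trans (le_of_eq (Finset.sum_congr rfl fun α hα => by rw [h α hα]))
    (Finset.sum_le_sum_of_subset_of_nonneg hs fun α _ _ =>
      mul_nonneg (abs_nonneg _) (monomialWeight_nonneg hw α))

lemma weightedNorm_weightedHomogeneousComponent_le (hw : ∀ i, 0 ≤ w i) (d : σ → ℕ) (m : ℕ)
    (p : MvPolynomial σ ℝ) :
    weightedNorm w (MvPolynomial.weightedHomogeneousComponent d m p) ≤ weightedNorm w p := by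
  classical
  refine weightedNorm_le_of_coeff hw fun α hα => ?_
  rw [MvPolynomial.mem_support_iff, MvPolynomial.coeff_weightedHomogeneousComponent] at hα
  rw [MvPolynomial.coeff_weightedHomogeneousComponent, if_pos]
  by_contra h
  exact hα (if_neg h)

end weightedNorm

/-! ### Gröbner bases and norm-decreasing normal forms -/

section NormalForm

open scoped MonomialOrder

variable {σ : Type*} {m : MonomialOrder σ}

/-- Dickson's lemma: the minimal leading exponents of `I` form an antichain in `σ →₀ ℕ`, hence a
finite set. One element of `I` for each gives a Gröbner basis. -/
lemma exists_finset_degree_le [Finite σ] (m : MonomialOrder σ) (I : Ideal (MvPolynomial σ ℝ)) :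
    ∃ G : Finset (MvPolynomial σ ℝ), (∀ g ∈ G, g ∈ I ∧ g ≠ 0) ∧
      ∀ f ∈ I, f ≠ 0 → ∃ g ∈ G, m.degree g ≤ m.degree f := by
  classical
  set D : Set (σ →₀ ℕ) := {d | ∃ g ∈ I, g ≠ 0 ∧ m.degree g = d} with hD
  have hfin : {d | Minimal (· ∈ D) d}.Finite :=
    WellQuasiOrderedLE.finite_of_isAntichain (setOfPred_minimal_antichain _)
  have hsec : ∀ d ∈ D, ∃ g ∈ I, g ≠ 0 ∧ m.degree g = d := fun d hd => hd
  choose! s hs1 hs2 hs3 using hsec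
  refine ⟨hfin.toFinset.image s, ?_, ?_⟩
  · intro g hg
    obtain ⟨d, hd, rfl⟩ := Finset.mem_image.mp hg
    have hd' : d ∈ D := ((Set.Finite.mem_toFinset hfin).mp hd).prop
    exact ⟨hs1 d hd', hs2 d hd'⟩
  · intro f hf hf0
    obtain ⟨d, hdle, hd⟩ := exists_minimal_le_of_wellFoundedLT (· ∈ D) (m.degree f) ⟨f, hf, hf0, rfl⟩
    exact ⟨s d, Finset.mem_image_of_mem s ((Set.Finite.mem_toFinset hfin).mpr hd),
      (hs3 d hd.prop).trans_le hdle⟩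

/-- The weights for which the leading term of every `g ∈ G` dominates its other terms. -/
def dominatingWeights (m : MonomialOrder σ) (G : Finset (MvPolynomial σ ℝ)) : Set (σ → ℝ) :=
  {w | (∀ i, 0 < w i) ∧ ∀ g ∈ G,
    weightedNorm w (g - m.leadingTerm g) ≤ |m.leadingCoeff g| * monomialWeight w (m.degree g)}

lemma support_sub_leadingTerm_lt (g : MvPolynomial σ ℝ) {γ : σ →₀ ℕ}
    (hγ : γ ∈ (g - m.leadingTerm g).support) : γ ≺[m] m.degree g := by
  classical
  have hne : γ ≠ m.degree g := by
    rintro rfl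
    simp [MonomialOrder.leadingTerm, MonomialOrder.leadingCoeff] at hγ
  have hg : γ ∈ g.support := by
    rw [MvPolynomial.mem_support_iff] at hγ ⊢
    simpa [MonomialOrder.leadingTerm, MvPolynomial.coeff_monomial, Ne.symm hne] using hγ
  exact lt_of_le_of_ne (m.le_degree hg) fun h => hne (m.toSyn.injective h)

/-- Division algorithm, by well-founded induction on `α`: a reducible monomial is traded for a
multiple of the tail of some `g ∈ G`, all of whose monomials are smaller. For dominating weights the
trade does not increase the norm. The remainder does not depend on `w`, so one `r` serves all such
weights. -/
lemma exists_normalForm_monomial (I : Ideal (MvPolynomial σ ℝ)) (G : Finset (MvPolynomial σ ℝ))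
    (hG : ∀ g ∈ G, g ∈ I ∧ g ≠ 0) (α : σ →₀ ℕ) :
    ∃ r : MvPolynomial σ ℝ, MvPolynomial.monomial α 1 - r ∈ I ∧
      (∀ β ∈ r.support, (∀ g ∈ G, ¬ m.degree g ≤ β) ∧ β ≼[m] α) ∧
      ∀ w ∈ dominatingWeights m G, weightedNorm w r ≤ monomialWeight w α := by
  classical
  have hwf : WellFounded fun a b : σ →₀ ℕ => a ≺[m] b :=
    InvImage.wf m.toSyn (wellFounded_lt)
  induction α using hwf.induction with
  | _ α ih =>
  by_cases hα : ∀ g ∈ G, ¬ m.degree g ≤ α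
  · refine ⟨MvPolynomial.monomial α 1, by simp, ?_, fun w _ => ?_⟩
    · intro β hβ
      have : β = α := Finset.mem_singleton.mp (MvPolynomial.support_monomial_subset hβ)
      subst this
      exact ⟨hα, le_rfl⟩
    · simp [weightedNorm_monomial]
  · push Not at hα
    obtain ⟨g, hg, hgα⟩ := hα
    obtain ⟨β, rfl⟩ := exists_add_of_le hgα
    have hlc : m.leadingCoeff g ≠ 0 := m.leadingCoeff_ne_zero_iff.mpr (hG g hg).2
    set t := g - m.leadingTerm g with ht
    have hlt : ∀ γ ∈ t.support, (γ + β) ≺[m] (m.degree g + β) := by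
      intro γ hγ
      rw [map_add, map_add]
      exact add_lt_add_left (support_sub_leadingTerm_lt g hγ) _
    have hih : ∀ γ ∈ t.support, _ := fun γ hγ => ih (γ + β) (hlt γ hγ)
    choose! r hr1 hr2 hr3 using hih
    -- Modulo `g`, the monomial `X^(deg g + β)` equals `-X^β t / lc(g)`; each monomial of the right
    -- side is then replaced by its own normal form.
    refine ⟨∑ γ ∈ t.support, MvPolynomial.C (-(t.coeff γ / m.leadingCoeff g)) * r γ, ?_, ?_, ?_⟩
    · have hg' : MvPolynomial.monomial β (m.leadingCoeff g)⁻¹ * g ∈ I := I.mul_mem_left _ (hG g hg).1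
      have hgt : g = MvPolynomial.monomial (m.degree g) (m.leadingCoeff g) +
          ∑ γ ∈ t.support, MvPolynomial.monomial γ (t.coeff γ) := by
        rw [← t.as_sum, ht, MonomialOrder.leadingTerm]
        ring
      have key : MvPolynomial.monomial (m.degree g + β) (1 : ℝ) -
          ∑ γ ∈ t.support, MvPolynomial.C (-(t.coeff γ / m.leadingCoeff g)) * r γ =
          MvPolynomial.monomial β (m.leadingCoeff g)⁻¹ * g -
          ∑ γ ∈ t.support, MvPolynomial.C (t.coeff γ / m.leadingCoeff g) *
            (MvPolynomial.monomial (γ + β) 1 - r γ) := by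
        have hmul := congrArg (MvPolynomial.monomial β (m.leadingCoeff g)⁻¹ * ·) hgt
        rw [hmul, mul_add, MvPolynomial.monomial_mul, inv_mul_cancel₀ hlc, Finset.mul_sum]
        simp only [mul_sub, Finset.sum_sub_distrib, MvPolynomial.monomial_mul,
          MvPolynomial.C_mul_monomial, mul_one, map_neg, neg_mul, Finset.sum_neg_distrib]
        have : ∑ γ ∈ t.support, MvPolynomial.monomial (β + γ)
            ((m.leadingCoeff g)⁻¹ * t.coeff γ) =
            ∑ γ ∈ t.support, MvPolynomial.monomial (γ + β) (t.coeff γ / m.leadingCoeff g) :=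
          Finset.sum_congr rfl fun γ _ => by rw [add_comm, div_eq_inv_mul]
        rw [this, add_comm β]
        ring
      rw [key]
      exact I.sub_mem hg' (I.sum_mem fun γ hγ => I.mul_mem_left _ (hr1 γ hγ))
    · intro δ hδ
      obtain ⟨γ, hγ, hδγ⟩ := Finset.mem_biUnion.mp (MvPolynomial.support_sum hδ)
      have hδr : δ ∈ (r γ).support := by
        rw [MvPolynomial.mem_support_iff, MvPolynomial.coeff_C_mul] at hδγ
        exact MvPolynomial.mem_support_iff.mpr (right_ne_zero_of_mul hδγ)
      exact ⟨(hr2 γ hγ δ hδr).1, ((hr2 γ hγ δ hδr).2.trans (hlt γ hγ).le)⟩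
    · intro w hw
      have hw0 : ∀ i, 0 ≤ w i := fun i => (hw.1 i).le
      calc weightedNorm w (∑ γ ∈ t.support, MvPolynomial.C (-(t.coeff γ / m.leadingCoeff g)) * r γ)
          ≤ ∑ γ ∈ t.support, |t.coeff γ| / |m.leadingCoeff g| *
              (monomialWeight w γ * monomialWeight w β) := by
            refine (weightedNorm_sum_le hw0 _ _).trans (Finset.sum_le_sum fun γ hγ => ?_)
            rw [weightedNorm_C_mul, abs_neg, abs_div, ← monomialWeight_add]
            exact mul_le_mul_of_nonneg_left (hr3 γ hγ w hw) (by positivity)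
        _ = weightedNorm w t * (monomialWeight w β / |m.leadingCoeff g|) := by
            rw [weightedNorm, Finset.sum_mul]
            exact Finset.sum_congr rfl fun γ _ => by ring
        _ ≤ (|m.leadingCoeff g| * monomialWeight w (m.degree g)) *
              (monomialWeight w β / |m.leadingCoeff g|) :=
            mul_le_mul_of_nonneg_right (hw.2 g hg)
              (div_nonneg (monomialWeight_nonneg hw0 β) (abs_nonneg _))
        _ = monomialWeight w (m.degree g + β) := by
            rw [monomialWeight_add]
            have : |m.leadingCoeff g| ≠ 0 := abs_ne_zero.mpr hlc
            field_simp

lemma exists_normalForm (I : Ideal (MvPolynomial σ ℝ)) (G : Finset (MvPolynomial σ ℝ))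
    (hG : ∀ g ∈ G, g ∈ I ∧ g ≠ 0) (p : MvPolynomial σ ℝ) :
    ∃ r : MvPolynomial σ ℝ, p - r ∈ I ∧
      (∀ β ∈ r.support, (∀ g ∈ G, ¬ m.degree g ≤ β) ∧ ∃ α ∈ p.support, β ≼[m] α) ∧
      ∀ w ∈ dominatingWeights m G, weightedNorm w r ≤ weightedNorm w p := by
  classical
  choose r hr1 hr2 hr3 using exists_normalForm_monomial (m := m) I G hG
  refine ⟨∑ α ∈ p.support, MvPolynomial.C (p.coeff α) * r α, ?_, ?_, ?_⟩
  · have : p - ∑ α ∈ p.support, MvPolynomial.C (p.coeff α) * r α =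
        ∑ α ∈ p.support, MvPolynomial.C (p.coeff α) * (MvPolynomial.monomial α 1 - r α) := by
      simp only [mul_sub, Finset.sum_sub_distrib, MvPolynomial.C_mul_monomial, mul_one]
      rw [← p.as_sum]
    rw [this]
    exact I.sum_mem fun α _ => I.mul_mem_left _ (hr1 α)
  · intro δ hδ
    obtain ⟨α, hα, hδα⟩ := Finset.mem_biUnion.mp (MvPolynomial.support_sum hδ)
    have hδr : δ ∈ (r α).support := by
      rw [MvPolynomial.mem_support_iff, MvPolynomial.coeff_C_mul] at hδα
      exact MvPolynomial.mem_support_iff.mpr (right_ne_zero_of_mul hδα)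
    exact ⟨(hr2 α δ hδr).1, α, hα, (hr2 α δ hδr).2⟩
  · intro w hw
    refine (weightedNorm_sum_le (fun i => (hw.1 i).le) _ _).trans
      (Finset.sum_le_sum fun α _ => ?_)
    rw [weightedNorm_C_mul]
    exact mul_le_mul_of_nonneg_left (hr3 α w hw) (abs_nonneg _)

/-- Otherwise the leading exponent of `r - s` would be divisible by that of some `g ∈ G`, although
it occurs in `r` or in `s`. -/
lemma normalForm_unique {I : Ideal (MvPolynomial σ ℝ)} {G : Finset (MvPolynomial σ ℝ)}
    (hG : ∀ f ∈ I, f ≠ 0 → ∃ g ∈ G, m.degree g ≤ m.degree f) {r s : MvPolynomial σ ℝ}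
    (hr : ∀ β ∈ r.support, ∀ g ∈ G, ¬ m.degree g ≤ β)
    (hs : ∀ β ∈ s.support, ∀ g ∈ G, ¬ m.degree g ≤ β) (h : r - s ∈ I) : r = s := by
  classical
  by_contra hne
  have h0 : r - s ≠ 0 := sub_ne_zero.mpr hne
  obtain ⟨g, hg, hle⟩ := hG _ h h0
  rcases Finset.mem_union.mp (MvPolynomial.support_sub _ r s (m.degree_mem_support h0)) with h | h
  · exact hr _ h g hg hle
  · exact hs _ h g hg hle

end NormalForm

/-! ### Elimination and bounded lifts through the generators -/

section Elimination

open scoped MonomialOrder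

lemma sum_pow_mul_lt_pow {N B : ℕ} (γ : Fin N → ℕ) (hγ : ∀ i, γ i < B) :
    ∑ j : Fin N, B ^ (N - 1 - (j : ℕ)) * γ j < B ^ N := by
  induction N with
  | zero => simp
  | succ N ih =>
    have h := ih (fun j => γ j.succ) fun j => hγ _
    rw [Fin.sum_univ_succ]
    have h1 : ∀ j : Fin N, N - (j.succ : ℕ) = N - 1 - (j : ℕ) := fun j => by
      simp only [Fin.val_succ]; omega
    simp only [h1, Fin.val_zero, Nat.sub_zero, Nat.add_sub_cancel]
    calc _ < B ^ N * γ 0 + B ^ N := by omega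
      _ = B ^ N * (γ 0 + 1) := by ring
      _ ≤ B ^ N * B := Nat.mul_le_mul_left _ (hγ 0)
      _ = B ^ (N + 1) := by ring

/-- Reading exponents as base `B` digits makes lexicographic comparison numerical: at the first
difference `δ` gains a full unit of that place, more than the remaining digits of `γ` can make up.
Only the smaller exponent needs digits below `B`. -/
lemma sum_pow_mul_lt_of_lex {N B : ℕ} (γ δ : Fin N → ℕ) (hγ : ∀ i, γ i < B)
    (h : ∃ i, (∀ j < i, γ j = δ j) ∧ γ i < δ i) :
    ∑ j : Fin N, B ^ (N - 1 - (j : ℕ)) * γ j < ∑ j : Fin N, B ^ (N - 1 - (j : ℕ)) * δ j := by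
  induction N with
  | zero => obtain ⟨i, -⟩ := h; exact i.elim0
  | succ N ih =>
    obtain ⟨i, hi, hlt⟩ := h
    rw [Fin.sum_univ_succ, Fin.sum_univ_succ]
    have h1 : ∀ j : Fin N, N - (j.succ : ℕ) = N - 1 - (j : ℕ) := fun j => by
      simp only [Fin.val_succ]; omega
    simp only [h1, Fin.val_zero, Nat.sub_zero, Nat.add_sub_cancel]
    induction i using Fin.cases with
    | zero =>
      have h2 := sum_pow_mul_lt_pow (fun j : Fin N => γ j.succ) fun j => hγ _
      calc _ < B ^ N * γ 0 + B ^ N := by omega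
        _ = B ^ N * (γ 0 + 1) := by ring
        _ ≤ B ^ N * δ 0 := Nat.mul_le_mul_left _ hlt
        _ ≤ _ := Nat.le_add_right _ _
    | succ i =>
      have h2 := ih (fun j => γ j.succ) (fun j => δ j.succ) (fun j => hγ _)
        ⟨i, fun j hj => hi _ (Fin.succ_lt_succ_iff.mpr hj), hlt⟩
      rw [hi 0 (Fin.succ_pos i)]
      omega

lemma lex_lt_iff_exists {N : ℕ} {γ δ : Fin N →₀ ℕ} :
    γ ≺[MonomialOrder.lex] δ ↔ ∃ i, (∀ j < i, γ j = δ j) ∧ γ i < δ i := by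
  rw [MonomialOrder.lex_lt_iff]
  exact Iff.rfl

/-- With `w_i = M^(B^(N-1-i))` the weight of a monomial is `M` to its base `B` value, so a
lexicographically smaller monomial of `g` loses at least one factor `M`. It suffices that `M` exceed
the ratio of the tail coefficients to the leading one, for each `g`. -/
lemma exists_dominatingWeights_ge {N : ℕ} (G : Finset (MvPolynomial (Fin N) ℝ))
    (hG : ∀ g ∈ G, g ≠ 0) (R : ℝ) :
    ∃ w ∈ dominatingWeights MonomialOrder.lex G, ∀ i, R ≤ w i := by
  classical
  obtain ⟨B, hB0, hB⟩ : ∃ B : ℕ, 0 < B ∧ ∀ g ∈ G, ∀ γ ∈ g.support, ∀ i, γ i < B := by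
    -- A crude bound: one more than the sum of all exponents occurring in `G`.
    refine ⟨1 + ∑ g ∈ G, ∑ γ ∈ g.support, ∑ i, γ i, by omega, fun g hg γ hγ i => ?_⟩
    have h1 : γ i ≤ ∑ i, γ i := Finset.single_le_sum (fun _ _ => Nat.zero_le _) (Finset.mem_univ i)
    have h2 : ∑ i, γ i ≤ ∑ γ ∈ g.support, ∑ i, γ i :=
      Finset.single_le_sum (f := fun γ : Fin N →₀ ℕ => ∑ i, γ i) (fun _ _ => Nat.zero_le _) hγ
    have h3 : ∑ γ ∈ g.support, ∑ i, γ i ≤ ∑ g ∈ G, ∑ γ ∈ g.support, ∑ i, γ i :=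
      Finset.single_le_sum (f := fun g : MvPolynomial (Fin N) ℝ => ∑ γ ∈ g.support, ∑ i, γ i)
        (fun _ _ => Nat.zero_le _) hg
    omega
  set c : MvPolynomial (Fin N) ℝ → ℝ := fun g =>
    (∑ γ ∈ (g - MonomialOrder.lex.leadingTerm g).support,
      |(g - MonomialOrder.lex.leadingTerm g).coeff γ|) / |MonomialOrder.lex.leadingCoeff g| with hc
  have hc0 : ∀ g, 0 ≤ c g := fun g => by positivity
  set M : ℝ := max 1 R + ∑ g ∈ G, c g with hM
  have hM1 : 1 ≤ M := (le_max_left _ _).trans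
    (le_add_of_nonneg_right (Finset.sum_nonneg fun g _ => hc0 g))
  have hMR : R ≤ M := (le_max_right _ _).trans
    (le_add_of_nonneg_right (Finset.sum_nonneg fun g _ => hc0 g))
  have hMc : ∀ g ∈ G, c g ≤ M := fun g hg =>
    (Finset.single_le_sum (fun g _ => hc0 g) hg).trans
      (le_add_of_nonneg_left (zero_le_one.trans (le_max_left _ _)))
  have hM0 : 0 < M := zero_lt_one.trans_le hM1
  set w : Fin N → ℝ := fun i => M ^ (B ^ (N - 1 - (i : ℕ))) with hw
  have hmw : ∀ γ : Fin N →₀ ℕ, monomialWeight w γ = M ^ (∑ j : Fin N, B ^ (N - 1 - (j : ℕ)) * γ j) := by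
    intro γ
    rw [monomialWeight, Finsupp.prod_fintype _ _ (by simp), ← Finset.prod_pow_eq_pow_sum]
    exact Finset.prod_congr rfl fun i _ => by rw [hw, pow_mul]
  refine ⟨w, ⟨fun i => by positivity, fun g hg => ?_⟩, fun i =>
    hMR.trans (le_self_pow₀ hM1 (pow_pos hB0 _).ne')⟩
  have hlc : 0 < |MonomialOrder.lex.leadingCoeff g| :=
    abs_pos.mpr (MonomialOrder.lex.leadingCoeff_ne_zero_iff.mpr (hG g hg))
  have hle : ∀ γ ∈ (g - MonomialOrder.lex.leadingTerm g).support,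
      monomialWeight w γ ≤ monomialWeight w (MonomialOrder.lex.degree g) / M := by
    intro γ hγ
    have hlt := support_sub_leadingTerm_lt g hγ
    have hγg : γ ∈ g.support := by
      rw [MvPolynomial.mem_support_iff] at hγ ⊢
      have hne : MonomialOrder.lex.degree g ≠ γ := fun h => by simp [h] at hlt
      simpa [MonomialOrder.leadingTerm, MvPolynomial.coeff_monomial, hne] using hγ
    rw [le_div_iff₀ hM0, hmw, hmw, ← pow_succ]
    exact pow_le_pow_right₀ hM1
      (sum_pow_mul_lt_of_lex (⇑γ) _ (hB g hg γ hγg) (lex_lt_iff_exists.mp hlt))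
  calc weightedNorm w (g - MonomialOrder.lex.leadingTerm g)
      ≤ ∑ γ ∈ (g - MonomialOrder.lex.leadingTerm g).support,
        |(g - MonomialOrder.lex.leadingTerm g).coeff γ| *
          (monomialWeight w (MonomialOrder.lex.degree g) / M) :=
        Finset.sum_le_sum fun γ hγ => mul_le_mul_of_nonneg_left (hle γ hγ) (abs_nonneg _)
    _ = c g * |MonomialOrder.lex.leadingCoeff g| *
          (monomialWeight w (MonomialOrder.lex.degree g) / M) := by
        rw [← Finset.sum_mul, hc, div_mul_cancel₀ _ hlc.ne']
    _ ≤ M * |MonomialOrder.lex.leadingCoeff g| *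
          (monomialWeight w (MonomialOrder.lex.degree g) / M) := by
        have := monomialWeight_nonneg (w := w) (fun i => by positivity)
          (MonomialOrder.lex.degree g)
        have := hMc g hg
        gcongr
    _ = _ := by field_simp

/-- The elimination property: at the first difference `α` is positive, so it lies among the last `ℓ`
variables, and the first `n` exponents agree. -/
lemma lex_le_castAdd_eq_zero {n ℓ : ℕ} {α β : Fin (n + ℓ) →₀ ℕ}
    (hα : ∀ i, α (Fin.castAdd ℓ i) = 0) (h : β ≼[MonomialOrder.lex] α) (i : Fin n) :
    β (Fin.castAdd ℓ i) = 0 := by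
  rcases h.lt_or_eq with h | h
  · obtain ⟨k, hk, hlt⟩ := lex_lt_iff_exists.mp h
    have hki : Fin.castAdd ℓ i < k := by
      by_contra hcon
      have hkn : (k : ℕ) < n := (Fin.le_def.mp (not_lt.mp hcon)).trans_lt i.2
      have := hα ⟨k, hkn⟩
      have hk' : Fin.castAdd ℓ (⟨k, hkn⟩ : Fin n) = k := rfl
      rw [hk'] at this
      omega
    rw [hk _ hki, hα]
  · rw [MonomialOrder.lex.toSyn.injective h, hα]

/-- Every subalgebra of a polynomial ring generated by finitely many `ρ j` admits a section of
`F ↦ F(ρ)` which is bounded for the weighted `ℓ¹` norms. -/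
theorem exists_lift_weightedNorm_le {n ℓ : ℕ} (ρ : Fin ℓ → MvPolynomial (Fin n) ℝ) :
    ∃ S : MvPolynomial (Fin n) ℝ → MvPolynomial (Fin ℓ) ℝ,
      (∀ p ∈ Algebra.adjoin ℝ (Set.range ρ), MvPolynomial.aeval ρ (S p) = p) ∧
      ∀ R : ℝ, 0 ≤ R → ∃ C : ℝ, 0 ≤ C ∧ ∀ p ∈ Algebra.adjoin ℝ (Set.range ρ),
        weightedNorm (fun _ => R) (S p) ≤ weightedNorm (fun _ => C) p := by
  classical
  set φ : MvPolynomial (Fin (n + ℓ)) ℝ →ₐ[ℝ] MvPolynomial (Fin n) ℝ :=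
    MvPolynomial.aeval (Fin.append MvPolynomial.X ρ) with hφ
  have hφl : ∀ p, φ (MvPolynomial.rename (Fin.castAdd ℓ) p) = p := fun p => by
    rw [hφ, MvPolynomial.aeval_rename]
    have : Fin.append (MvPolynomial.X (R := ℝ)) ρ ∘ Fin.castAdd ℓ = MvPolynomial.X := by
      ext1 i; simp
    rw [this, MvPolynomial.aeval_X_left_apply]
  have hφr : ∀ F, φ (MvPolynomial.rename (Fin.natAdd n) F) = MvPolynomial.aeval ρ F := fun p => by
    rw [hφ, MvPolynomial.aeval_rename]
    have : Fin.append (MvPolynomial.X (R := ℝ)) ρ ∘ Fin.natAdd n = ρ := by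
      ext1 i; simp
    rw [this]
  set I : Ideal (MvPolynomial (Fin (n + ℓ)) ℝ) := RingHom.ker φ with hI
  obtain ⟨G, hG, hGdeg⟩ := exists_finset_degree_le MonomialOrder.lex I
  have hex : ∀ p ∈ Algebra.adjoin ℝ (Set.range ρ), ∃ F : MvPolynomial (Fin ℓ) ℝ,
      MvPolynomial.aeval ρ F = p ∧ ∀ w ∈ dominatingWeights MonomialOrder.lex G,
        weightedNorm w (MvPolynomial.rename (Fin.natAdd n) F) ≤
          weightedNorm w (MvPolynomial.rename (Fin.castAdd ℓ) p) := by
    intro p hp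
    rw [Algebra.adjoin_range_eq_range_aeval] at hp
    obtain ⟨F, rfl⟩ := hp
    obtain ⟨r, hr1, hr2, hr3⟩ := exists_normalForm (m := MonomialOrder.lex) I G hG
      (MvPolynomial.rename (Fin.castAdd ℓ) (MvPolynomial.aeval ρ F))
    obtain ⟨s, hs1, hs2, -⟩ := exists_normalForm (m := MonomialOrder.lex) I G hG
      (MvPolynomial.rename (Fin.natAdd n) F)
    have hφrs : φ r = MvPolynomial.aeval ρ F := by
      rw [hI, RingHom.mem_ker, map_sub, sub_eq_zero, hφl] at hr1
      exact hr1.symm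
    -- `r` and `s` are the normal forms of `p(x)` and `F(t)`. These two polynomials have the same
    -- image under `φ`, so the normal forms coincide: `r` inherits the norm bound from `p` and the
    -- absence of the variables `x` from `F`.
    have hrs : r = s := by
      refine normalForm_unique hGdeg (fun β hβ => (hr2 β hβ).1) (fun β hβ => (hs2 β hβ).1) ?_
      rw [hI, RingHom.mem_ker, map_sub, sub_eq_zero, hφr] at hs1
      rw [hI, RingHom.mem_ker, map_sub, sub_eq_zero]
      exact hφrs.trans hs1
    have hvars : (r.vars : Set (Fin (n + ℓ))) ⊆ Set.range (Fin.natAdd n) := by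
      intro i hi
      obtain ⟨β, hβ, hiβ⟩ := MvPolynomial.mem_vars_iff_mem_support i |>.mp hi
      rw [hrs] at hβ
      obtain ⟨-, α, hα, hle⟩ := hs2 β hβ
      have hα0 : ∀ j, α (Fin.castAdd ℓ j) = 0 := by
        intro j
        rw [MvPolynomial.support_rename_of_injective (Fin.natAdd_injective ℓ n)] at hα
        obtain ⟨α', -, rfl⟩ := Finset.mem_image.mp hα
        refine Finsupp.mapDomain_of_notMem_range _ _ ?_
        rintro ⟨k, hk⟩
        have := congrArg Fin.val hk
        simp only [Fin.val_natAdd, Fin.val_castAdd] at this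
        have := j.2
        omega
      induction i using Fin.addCases with
      | left i => exact absurd (lex_le_castAdd_eq_zero hα0 hle i) (Finsupp.mem_support_iff.mp hiβ)
      | right i => exact ⟨i, rfl⟩
    obtain ⟨H, hH⟩ := MvPolynomial.exists_rename_eq_of_vars_subset_range r (Fin.natAdd n)
      (Fin.natAdd_injective ℓ n) hvars
    refine ⟨H, ?_, fun w hw => ?_⟩
    · rw [← hφr, hH]
      exact hφrs
    · rw [hH]
      exact hr3 w hw
  choose! S hS1 hS2 using hex
  refine ⟨S, hS1, fun R hR => ?_⟩
  obtain ⟨w, hw, hwR⟩ := exists_dominatingWeights_ge G (fun g hg => (hG g hg).2) R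
  have hw0 : ∀ i, 0 ≤ w i := fun i => (hw.1 i).le
  -- Dominating weights differ between variables; constant ones are recovered by `R ≤ w i` on the
  -- `t` side and `w i ≤ ∑ w` on the `x` side.
  refine ⟨∑ i, w i, Finset.sum_nonneg fun i _ => hw0 i, fun p hp => ?_⟩
  have h := hS2 p hp w hw
  rw [weightedNorm_rename (Fin.natAdd_injective ℓ n),
    weightedNorm_rename (Fin.castAdd_injective n ℓ)] at h
  exact (weightedNorm_mono (fun _ => hR) (fun i => hwR _) _).trans
    (h.trans (weightedNorm_mono (fun _ => hw0 _)
      (fun i => Finset.single_le_sum (fun i _ => hw0 i) (Finset.mem_univ _)) _))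

end Elimination

/-! ### The multinomial theorem with divided powers -/

section Multinomial

lemma sum_pow_div_factorial {𝕜 : Type*} [Field 𝕜] [CharZero 𝕜] {n : ℕ} (y : Fin n → 𝕜) (m : ℕ) :
    (∑ i, y i) ^ m / (m.factorial : 𝕜) =
      ∑ α ∈ Finset.univ.piAntidiag m, (∏ i, y i ^ α i) / (∏ i, ((α i).factorial : 𝕜)) := by
  rw [Finset.sum_pow_eq_sum_piAntidiag, Finset.sum_div]
  refine Finset.sum_congr rfl fun α hα => ?_
  have hsum : ∑ i, α i = m := (Finset.mem_piAntidiag.mp hα).1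
  have hspec := congrArg (Nat.cast (R := 𝕜)) (Nat.multinomial_spec Finset.univ α)
  rw [hsum] at hspec
  push_cast at hspec
  have h1 : (m.factorial : 𝕜) ≠ 0 := Nat.cast_ne_zero.mpr m.factorial_ne_zero
  have h2 : (∏ i, ((α i).factorial : 𝕜)) ≠ 0 :=
    Finset.prod_ne_zero_iff.mpr fun i _ => Nat.cast_ne_zero.mpr (Nat.factorial_ne_zero _)
  rw [div_eq_div_iff h1 h2, ← hspec]
  ring

end Multinomial

/-! ### Normalized Haar measure -/

section Haar

variable {K : Type*} [Group K] [TopologicalSpace K] [IsTopologicalGroup K]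
  [CompactSpace K] [MeasurableSpace K] [BorelSpace K]

/-- The Haar measure of total mass `1` on a compact group. -/
noncomputable abbrev probHaar (K : Type*) [Group K] [TopologicalSpace K] [IsTopologicalGroup K]
    [CompactSpace K] [MeasurableSpace K] [BorelSpace K] : Measure K :=
  Measure.haarMeasure ⊤

instance isProbabilityMeasure_probHaar : IsProbabilityMeasure (probHaar K) :=
  ⟨by simpa using Measure.haarMeasure_self (K₀ := (⊤ : TopologicalSpace.PositiveCompacts K))⟩

instance isMulRightInvariant_probHaar : (probHaar K).IsMulRightInvariant := by
  refine ⟨fun g => ?_⟩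
  have : IsProbabilityMeasure (Measure.map (· * g) (probHaar K)) :=
    Measure.isProbabilityMeasure_map (measurable_mul_const g).aemeasurable
  exact Measure.isHaarMeasure_eq_of_isProbabilityMeasure _ _

lemma Continuous.integrable_probHaar {E : Type*} [NormedAddCommGroup E]
    [SecondCountableTopology E] {f : K → E} (hf : Continuous f) : Integrable f (probHaar K) :=
  hf.integrable_of_hasCompactSupport (HasCompactSupport.of_compactSpace f)

end Haar

/-! ### Averages of monomials over the group -/

section Average

variable {n : ℕ} {K : Type*} [Group K]
    (π : K →* (EuclideanSpace ℝ (Fin n) ≃ₗᵢ[ℝ] EuclideanSpace ℝ (Fin n)))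

/-- The monomial `X^α` composed with the orthogonal map `π k`. -/
noncomputable def rotatedMonomial (α : Fin n → ℕ) (k : K) : MvPolynomial (Fin n) ℝ :=
  ∏ i, (∑ j, MvPolynomial.C (π k (EuclideanSpace.single j 1) i) * MvPolynomial.X j) ^ α i

lemma apply_eq_sum_single (k : K) (x : EuclideanSpace ℝ (Fin n)) (i : Fin n) :
    π k x i = ∑ j, π k (EuclideanSpace.single j 1) i * x j := by
  have hx : x = ∑ j, x j • EuclideanSpace.single j (1 : ℝ) := by
    ext i
    simp [Finset.sum_apply, Pi.single_apply]
  conv_lhs => rw [hx]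
  simp [map_sum, mul_comm]

lemma eval_rotatedMonomial (α : Fin n → ℕ) (k : K) (x : EuclideanSpace ℝ (Fin n)) :
    MvPolynomial.eval (fun i => x i) (rotatedMonomial π α k) = ∏ i, (π k x i) ^ α i := by
  simp only [rotatedMonomial, map_prod, map_pow, map_sum, map_mul, MvPolynomial.eval_C,
    MvPolynomial.eval_X, ← apply_eq_sum_single]

lemma isHomogeneous_rotatedMonomial (α : Fin n → ℕ) (k : K) :
    (rotatedMonomial π α k).IsHomogeneous (∑ i, α i) := by
  refine MvPolynomial.IsHomogeneous.prod _ _ _ fun i _ => ?_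
  have h : (∑ j, MvPolynomial.C (π k (EuclideanSpace.single j 1) i) *
      MvPolynomial.X (R := ℝ) j).IsHomogeneous 1 :=
    MvPolynomial.IsHomogeneous.sum _ _ _ fun j _ => MvPolynomial.isHomogeneous_C_mul_X _ _
  simpa using h.pow (α i)

lemma support_rotatedMonomial_subset (α : Fin n → ℕ) (k : K) :
    (rotatedMonomial π α k).support ⊆ Finset.univ.finsuppAntidiag (∑ i, α i) := by
  intro β hβ
  rw [Finset.mem_finsuppAntidiag]
  refine ⟨?_, Finset.subset_univ _⟩
  have h := (isHomogeneous_rotatedMonomial π α k) (MvPolynomial.mem_support_iff.mp hβ)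
  rw [← h, Finsupp.weight_apply, Finsupp.sum_fintype _ _ (by simp)]
  simp

lemma abs_apply_single_le_one (k : K) (i j : Fin n) :
    |π k (EuclideanSpace.single j 1) i| ≤ 1 := by
  have h := EuclideanSpace.norm_eq (π k (EuclideanSpace.single j 1))
  calc |π k (EuclideanSpace.single j 1) i| ≤ ‖π k (EuclideanSpace.single j (1 : ℝ))‖ :=
        PiLp.norm_apply_le (π k (EuclideanSpace.single j (1 : ℝ))) i
    _ = 1 := by simp

/-- Each variable is replaced by a linear form with `n` coefficients of absolute value at most `1`,
hence of norm at most `n * C`; the norm is submultiplicative. -/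
lemma weightedNorm_rotatedMonomial_le {C : ℝ} (hC : 0 ≤ C) (α : Fin n → ℕ) (k : K) :
    weightedNorm (fun _ => C) (rotatedMonomial π α k) ≤ (n * C) ^ ∑ i, α i := by
  have h0 : ∀ _ : Fin n, 0 ≤ C := fun _ => hC
  rw [← Finset.prod_pow_eq_pow_sum]
  refine (weightedNorm_prod_le h0 _ _).trans (Finset.prod_le_prod
    (fun i _ => weightedNorm_nonneg h0 _) fun i _ => (weightedNorm_pow_le h0 _ _).trans
      (pow_le_pow_left₀ (weightedNorm_nonneg h0 _) ?_ _))
  refine (weightedNorm_sum_le h0 _ _).trans ?_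
  calc _ ≤ ∑ _j : Fin n, C := Finset.sum_le_sum fun j _ => by
        rw [weightedNorm_C_mul, MvPolynomial.X, weightedNorm_monomial, monomialWeight_const]
        simpa using mul_le_mul_of_nonneg_right (abs_apply_single_le_one π k i j) hC
    _ = n * C := by simp

variable [TopologicalSpace K]

lemma continuous_coeff_mul {τ σ : Type*} [TopologicalSpace τ] {f g : τ → MvPolynomial σ ℝ}
    (hf : ∀ β, Continuous fun k => (f k).coeff β) (hg : ∀ β, Continuous fun k => (g k).coeff β)
    (β : σ →₀ ℕ) : Continuous fun k => (f k * g k).coeff β := by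
  classical
  simp only [MvPolynomial.coeff_mul]
  exact continuous_finsetSum _ fun p _ => (hf _).mul (hg _)

lemma continuous_coeff_rotatedMonomial
    (hπ : Continuous fun p : K × EuclideanSpace ℝ (Fin n) => π p.1 p.2)
    (α : Fin n → ℕ) (β : Fin n →₀ ℕ) :
    Continuous fun k => (rotatedMonomial π α k).coeff β := by
  classical
  have hlin : ∀ i β, Continuous fun k => (∑ j, MvPolynomial.C (π k (EuclideanSpace.single j 1) i) *
      MvPolynomial.X (R := ℝ) j).coeff β := by
    intro i β
    simp only [MvPolynomial.coeff_sum, MvPolynomial.coeff_C_mul]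
    refine continuous_finsetSum _ fun j _ => Continuous.mul ?_ continuous_const
    have h1 : Continuous fun k : K => π k (EuclideanSpace.single j (1 : ℝ)) :=
      hπ.comp (by fun_prop : Continuous fun k : K => (k, EuclideanSpace.single j (1 : ℝ)))
    exact (EuclideanSpace.proj (𝕜 := ℝ) i).continuous.comp h1
  have hpow : ∀ i N β, Continuous fun k =>
      ((∑ j, MvPolynomial.C (π k (EuclideanSpace.single j 1) i) *
        MvPolynomial.X (R := ℝ) j) ^ N).coeff β := by
    intro i N
    induction N with
    | zero => intro β; simpa using continuous_const
    | succ N ih =>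
      intro β
      simp only [pow_succ]
      exact continuous_coeff_mul ih (hlin i) β
  have hprod : ∀ (s : Finset (Fin n)) β, Continuous fun k =>
      (∏ i ∈ s, (∑ j, MvPolynomial.C (π k (EuclideanSpace.single j 1) i) *
        MvPolynomial.X (R := ℝ) j) ^ α i).coeff β := by
    intro s
    induction s using Finset.induction_on with
    | empty => intro β; simpa using continuous_const
    | insert i s hi ih =>
      intro β
      simp only [Finset.prod_insert hi]
      exact continuous_coeff_mul (hpow i _) ih β
  exact hprod Finset.univ β

variable [IsTopologicalGroup K] [CompactSpace K] [MeasurableSpace K] [BorelSpace K]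

/-- The average over `K` of the monomial `X^α`, as a polynomial. -/
noncomputable def averagedMonomial (α : Fin n → ℕ) : MvPolynomial (Fin n) ℝ :=
  ∑ β ∈ Finset.univ.finsuppAntidiag (∑ i, α i),
    MvPolynomial.monomial β (∫ k, (rotatedMonomial π α k).coeff β ∂(probHaar K))

lemma eval_averagedMonomial
    (hπ : Continuous fun p : K × EuclideanSpace ℝ (Fin n) => π p.1 p.2)
    (α : Fin n → ℕ) (x : EuclideanSpace ℝ (Fin n)) :
    MvPolynomial.eval (fun i => x i) (averagedMonomial π α) =
      ∫ k, ∏ i, (π k x i) ^ α i ∂(probHaar K) := by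
  have h : ∀ k, ∏ i, (π k x i) ^ α i = ∑ β ∈ Finset.univ.finsuppAntidiag (∑ i, α i),
      (rotatedMonomial π α k).coeff β * ∏ i, x i ^ β i := by
    intro k
    rw [← eval_rotatedMonomial, MvPolynomial.eval_eq']
    refine Finset.sum_subset (support_rotatedMonomial_subset π α k) fun β _ hβ => ?_
    rw [MvPolynomial.notMem_support_iff.mp hβ, zero_mul]
  simp only [h]
  rw [integral_finsetSum _ fun β _ =>
    Continuous.integrable_probHaar
      ((continuous_coeff_rotatedMonomial π hπ α β).fun_mul continuous_const)]
  simp only [averagedMonomial, map_sum, MvPolynomial.eval_monomial, integral_mul_const]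
  exact Finset.sum_congr rfl fun β _ => by rw [Finsupp.prod_fintype _ _ (by simp)]

lemma averagedMonomial_mem
    (hπ : Continuous fun p : K × EuclideanSpace ℝ (Fin n) => π p.1 p.2) (α : Fin n → ℕ) :
    averagedMonomial π α ∈ invariantPolynomials π := by
  intro h x
  have h1 := eval_averagedMonomial π hπ α (π h x)
  rw [h1, eval_averagedMonomial π hπ]
  have := integral_mul_right_eq_self (μ := probHaar K) (fun k => ∏ i, (π k x i) ^ α i) h
  simpa [map_mul] using this

lemma isHomogeneous_averagedMonomial (α : Fin n → ℕ) :
    (averagedMonomial π α).IsHomogeneous (∑ i, α i) := by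
  refine MvPolynomial.IsHomogeneous.sum _ _ _ fun β hβ =>
    MvPolynomial.isHomogeneous_monomial _ ?_
  rw [← (Finset.mem_finsuppAntidiag.mp hβ).1, Finsupp.degree_eq_sum]

lemma weightedNorm_averagedMonomial_le
    (hπ : Continuous fun p : K × EuclideanSpace ℝ (Fin n) => π p.1 p.2)
    {C : ℝ} (hC : 0 ≤ C) (α : Fin n → ℕ) :
    weightedNorm (fun _ => C) (averagedMonomial π α) ≤ (n * C) ^ ∑ i, α i := by
  have h0 : ∀ _ : Fin n, 0 ≤ C := fun _ => hC
  have hint : ∀ β, Integrable (fun k => |(rotatedMonomial π α k).coeff β| *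
      monomialWeight (fun _ => C) β) (probHaar K) := fun β =>
    ((continuous_coeff_rotatedMonomial π hπ α β).abs.mul continuous_const).integrable_probHaar
  calc weightedNorm (fun _ => C) (averagedMonomial π α)
      ≤ ∑ β ∈ Finset.univ.finsuppAntidiag (∑ i, α i),
          |∫ k, (rotatedMonomial π α k).coeff β ∂(probHaar K)| *
            monomialWeight (fun _ => C) β := by
        refine (weightedNorm_sum_le h0 _ _).trans (le_of_eq ?_)
        simp only [weightedNorm_monomial]
    _ ≤ ∑ β ∈ Finset.univ.finsuppAntidiag (∑ i, α i),
          ∫ k, |(rotatedMonomial π α k).coeff β| * monomialWeight (fun _ => C) β ∂(probHaar K) := by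
        refine Finset.sum_le_sum fun β _ => ?_
        rw [integral_mul_const]
        exact mul_le_mul_of_nonneg_right abs_integral_le_integral_abs
          (monomialWeight_nonneg h0 β)
    _ = ∫ k, weightedNorm (fun _ => C) (rotatedMonomial π α k) ∂(probHaar K) := by
        rw [← integral_finsetSum _ fun β _ => hint β]
        exact integral_congr_ae (.of_forall fun k =>
          (weightedNorm_eq_sum _ (support_rotatedMonomial_subset π α k)).symm)
    _ ≤ (n * C) ^ ∑ i, α i := by
        have h1 : ∀ k, ‖weightedNorm (fun _ => C) (rotatedMonomial π α k)‖ ≤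
            (n * C) ^ ∑ i, α i := fun k => by
          rw [Real.norm_of_nonneg (weightedNorm_nonneg h0 _)]
          exact weightedNorm_rotatedMonomial_le π hC α k
        have h2 := norm_integral_le_of_norm_le_const (μ := probHaar K) (.of_forall h1)
        simpa using (le_abs_self _).trans h2

end Average

/-! ### Lifting the averaged monomials -/

section Lift

/-- For homogeneous generators this lets a lift of a homogeneous polynomial be cut down to its part
of the right weight, which still is a lift and has no larger norm. -/
lemma homogeneousComponent_aeval {n ℓ : ℕ} {ρ : Fin ℓ → MvPolynomial (Fin n) ℝ} {d : Fin ℓ → ℕ}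
    (hρ : ∀ j, (ρ j).IsHomogeneous (d j)) (m : ℕ) (F : MvPolynomial (Fin ℓ) ℝ) :
    MvPolynomial.homogeneousComponent m (MvPolynomial.aeval ρ F) =
      MvPolynomial.aeval ρ (MvPolynomial.weightedHomogeneousComponent d m F) := by
  classical
  induction F using MvPolynomial.induction_on' with
  | monomial J c =>
    have h1 : (MvPolynomial.aeval ρ (MvPolynomial.monomial J c)).IsHomogeneous
        (Finsupp.weight d J) := by
      rw [MvPolynomial.aeval_monomial, Finsupp.weight_apply, ← zero_add (J.sum _)]
      refine (MvPolynomial.isHomogeneous_C _ c).mul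
        (MvPolynomial.IsHomogeneous.prod _ _ _ fun j _ => ?_)
      change (ρ j ^ J j).IsHomogeneous (J j * d j)
      rw [mul_comm]
      exact (hρ j).pow _
    rw [MvPolynomial.weightedHomogeneousComponent_of_mem
      (MvPolynomial.isWeightedHomogeneous_monomial d J c rfl),
      MvPolynomial.homogeneousComponent_of_mem h1]
    split_ifs <;> simp
  | add p q hp hq => simp only [map_add, hp, hq]

lemma exists_lift_averagedMonomial {n ℓ : ℕ} {K : Type*} [Group K] [TopologicalSpace K]
    [IsTopologicalGroup K] [CompactSpace K] [MeasurableSpace K] [BorelSpace K]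
    (π : K →* (EuclideanSpace ℝ (Fin n) ≃ₗᵢ[ℝ] EuclideanSpace ℝ (Fin n)))
    (hπ : Continuous fun p : K × EuclideanSpace ℝ (Fin n) => π p.1 p.2)
    (ρ : Fin ℓ → MvPolynomial (Fin n) ℝ)
    (hρ : Algebra.adjoin ℝ (Set.range ρ) = invariantPolynomials π) :
    ∃ F : (Fin n → ℕ) → MvPolynomial (Fin ℓ) ℝ,
      (∀ α, MvPolynomial.aeval ρ (F α) = averagedMonomial π α) ∧
      (∀ R : ℝ, 0 ≤ R → ∃ D : ℝ, 0 ≤ D ∧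
        ∀ α, weightedNorm (fun _ => R) (F α) ≤ D ^ ∑ i, α i) ∧
      ((∀ j, (ρ j).IsHomogeneous (ρ j).totalDegree) →
        ∀ α, ∀ J ∈ (F α).support, ∑ j, J j * (ρ j).totalDegree = ∑ i, α i) := by
  classical
  obtain ⟨S, hS, hSb⟩ := exists_lift_weightedNorm_le ρ
  have hmem : ∀ α, averagedMonomial π α ∈ Algebra.adjoin ℝ (Set.range ρ) := fun α => by
    rw [hρ]
    exact averagedMonomial_mem π hπ α
  have hbound : ∀ R : ℝ, 0 ≤ R → ∃ D : ℝ, 0 ≤ D ∧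
      ∀ α, weightedNorm (fun _ => R) (S (averagedMonomial π α)) ≤ D ^ ∑ i, α i := fun R hR => by
    obtain ⟨C, hC, h⟩ := hSb R hR
    exact ⟨n * C, by positivity, fun α =>
      (h _ (hmem α)).trans (weightedNorm_averagedMonomial_le π hπ hC α)⟩
  by_cases hhom : ∀ j, (ρ j).IsHomogeneous (ρ j).totalDegree
  · refine ⟨fun α => MvPolynomial.weightedHomogeneousComponent (fun j => (ρ j).totalDegree)
      (∑ i, α i) (S (averagedMonomial π α)), fun α => ?_, fun R hR => ?_, fun _ α J hJ => ?_⟩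
    · rw [← homogeneousComponent_aeval hhom, hS _ (hmem α),
        MvPolynomial.homogeneousComponent_of_mem (isHomogeneous_averagedMonomial π α), if_pos rfl]
    · obtain ⟨D, hD, h⟩ := hbound R hR
      exact ⟨D, hD, fun α =>
        (weightedNorm_weightedHomogeneousComponent_le (fun _ => hR) _ _ _).trans (h α)⟩
    · rw [MvPolynomial.mem_support_iff, MvPolynomial.coeff_weightedHomogeneousComponent] at hJ
      have h : Finsupp.weight (fun j => (ρ j).totalDegree) J = ∑ i, α i := by
        by_contra hne
        exact hJ (if_neg hne)
      rw [← h, Finsupp.weight_apply, Finsupp.sum_fintype _ _ (by simp)]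
      simp
  · exact ⟨fun α => S (averagedMonomial π α), fun α => hS _ (hmem α), hbound,
      fun h => absurd h hhom⟩

end Lift

/-! ### Taylor expansion of the spherical functions -/

section TaylorExpansion

variable {n : ℕ} {K : Type*} [Group K] [TopologicalSpace K]
    (π : K →* (EuclideanSpace ℝ (Fin n) ≃ₗᵢ[ℝ] EuclideanSpace ℝ (Fin n)))

lemma continuous_apply_left
    (hπ : Continuous fun p : K × EuclideanSpace ℝ (Fin n) => π p.1 p.2)
    (ξ : EuclideanSpace ℝ (Fin n)) : Continuous fun k => π k ξ :=
  hπ.comp (by fun_prop : Continuous fun k : K => (k, ξ))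

lemma continuous_inner_apply
    (hπ : Continuous fun p : K × EuclideanSpace ℝ (Fin n) => π p.1 p.2)
    (x ξ : EuclideanSpace ℝ (Fin n)) : Continuous fun k => inner ℝ x (π k ξ) :=
  continuous_const.inner (continuous_apply_left π hπ ξ)

variable [IsTopologicalGroup K] [CompactSpace K] [MeasurableSpace K] [BorelSpace K]

/-- Along a ray the spherical function is the characteristic function of the law of `⟨x, kξ⟩`, so
its Taylor coefficients are moments. -/
lemma sphericalFunction_smul_eq_charFun
    (hπ : Continuous fun p : K × EuclideanSpace ℝ (Fin n) => π p.1 p.2)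
    (ξ x : EuclideanSpace ℝ (Fin n)) (s : ℝ) :
    sphericalFunction π ξ (s • x) =
      charFun (Measure.map (fun k => inner ℝ x (π k ξ)) (probHaar K)) s := by
  have hc := continuous_inner_apply π hπ x ξ
  rw [charFun_apply_real, integral_map hc.measurable.aemeasurable
    (by fun_prop), sphericalFunction]
  refine integral_congr_ae (.of_forall fun k => ?_)
  simp only [real_inner_smul_left]
  congr 1
  push_cast
  ring

lemma taylorComponent_sphericalFunction
    (hπ : Continuous fun p : K × EuclideanSpace ℝ (Fin n) => π p.1 p.2)
    (ξ x : EuclideanSpace ℝ (Fin n)) (m : ℕ) :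
    taylorComponent (sphericalFunction π ξ) m x =
      Complex.I ^ m * (((∫ k, (inner ℝ x (π k ξ)) ^ m ∂(probHaar K)) / m.factorial : ℝ) : ℂ) := by
  have hc := continuous_inner_apply π hπ x ξ
  have : IsProbabilityMeasure (Measure.map (fun k => inner ℝ x (π k ξ)) (probHaar K)) :=
    Measure.isProbabilityMeasure_map hc.measurable.aemeasurable
  have hmem : MemLp id m (Measure.map (fun k => inner ℝ x (π k ξ)) (probHaar K)) := by
    rw [memLp_map_measure_iff (by fun_prop) hc.measurable.aemeasurable]
    refine MemLp.of_bound hc.aestronglyMeasurable (‖x‖ * ‖ξ‖) (.of_forall fun k => ?_)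
    simpa using norm_inner_le_norm (𝕜 := ℝ) x (π k ξ)
  rw [taylorComponent]
  simp only [sphericalFunction_smul_eq_charFun π hπ ξ x]
  rw [iteratedDeriv_charFun_zero hmem,
    integral_map hc.measurable.aemeasurable (by fun_prop)]
  push_cast
  ring

lemma hasSum_taylorComponent_sphericalFunction
    (hπ : Continuous fun p : K × EuclideanSpace ℝ (Fin n) => π p.1 p.2)
    (ξ x : EuclideanSpace ℝ (Fin n)) :
    HasSum (fun m => taylorComponent (sphericalFunction π ξ) m x) (sphericalFunction π ξ x) := by
  have hc := continuous_inner_apply π hπ x ξ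
  have hF : ∀ m : ℕ, Continuous fun k =>
      (Complex.I * ((inner ℝ x (π k ξ) : ℝ) : ℂ)) ^ m / (m.factorial : ℂ) := fun m =>
    ((continuous_const.mul (Complex.continuous_ofReal.comp hc)).pow m).div_const _
  have hbound : ∀ (m : ℕ) k, ‖(Complex.I * ((inner ℝ x (π k ξ) : ℝ) : ℂ)) ^ m /
      (m.factorial : ℂ)‖ ≤ (‖x‖ * ‖ξ‖) ^ m / m.factorial := by
    intro m k
    rw [norm_div, norm_pow, norm_mul, Complex.norm_I, one_mul, Complex.norm_real,
      Complex.norm_natCast]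
    have h := norm_inner_le_norm (𝕜 := ℝ) x (π k ξ)
    rw [LinearIsometryEquiv.norm_map] at h
    gcongr
  have h := hasSum_integral_of_dominated_convergence (μ := probHaar K)
    (F := fun (m : ℕ) k => (Complex.I * ((inner ℝ x (π k ξ) : ℝ) : ℂ)) ^ m / (m.factorial : ℂ))
    (f := fun k => Complex.exp (Complex.I * ((inner ℝ x (π k ξ) : ℝ) : ℂ)))
    (fun m _ => (‖x‖ * ‖ξ‖) ^ m / m.factorial)
    (fun m => (hF m).aestronglyMeasurable) (fun m => .of_forall (hbound m))
    (.of_forall fun _ => Real.summable_pow_div_factorial _) (integrable_const _)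
    (.of_forall fun k => by
      rw [Complex.exp_eq_exp_ℂ]
      exact NormedSpace.expSeries_div_hasSum_exp _)
  have heq : (fun m => taylorComponent (sphericalFunction π ξ) m x) = fun m : ℕ =>
      ∫ k, (Complex.I * ((inner ℝ x (π k ξ) : ℝ) : ℂ)) ^ m / (m.factorial : ℂ) ∂(probHaar K) := by
    ext m
    rw [taylorComponent_sphericalFunction π hπ, integral_div]
    simp only [mul_pow, integral_const_mul]
    rw [Complex.ofReal_div, ← integral_complex_ofReal]
    push_cast
    ring
  rw [heq]
  exact h

lemma integral_inner_apply_left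
    (h : K) (x ξ : EuclideanSpace ℝ (Fin n)) (m : ℕ) :
    ∫ k, (inner ℝ (π h x) (π k ξ)) ^ m ∂(probHaar K) =
      ∫ k, (inner ℝ x (π k ξ)) ^ m ∂(probHaar K) := by
  rw [← integral_mul_left_eq_self (μ := probHaar K) (fun k => (inner ℝ (π h x) (π k ξ)) ^ m) h]
  simp [map_mul]

/-- Expanding `⟨x, kξ⟩^m` averages only the monomials in `ξ`. The integral is invariant under `x ↦
hx`, and a second average, over `h`, makes the factors in `x` invariant too. -/
lemma integral_inner_pow_div_factorial
    (hπ : Continuous fun p : K × EuclideanSpace ℝ (Fin n) => π p.1 p.2)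
    (x ξ : EuclideanSpace ℝ (Fin n)) (m : ℕ) :
    (∫ k, (inner ℝ x (π k ξ)) ^ m ∂(probHaar K)) / m.factorial =
      ∑ α ∈ Finset.univ.piAntidiag m, (∏ i, ((α i).factorial : ℝ))⁻¹ *
        MvPolynomial.eval (fun i => x i) (averagedMonomial π α) *
        MvPolynomial.eval (fun i => ξ i) (averagedMonomial π α) := by
  have hcont : ∀ (y : EuclideanSpace ℝ (Fin n)) (α : Fin n → ℕ),
      Continuous fun k => ∏ i, (π k y i) ^ α i := fun y α =>
    continuous_finsetProd _ fun i _ =>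
      ((EuclideanSpace.proj (𝕜 := ℝ) i).continuous.comp (continuous_apply_left π hπ y)).pow _
  have h1 : ∀ y : EuclideanSpace ℝ (Fin n),
      (∫ k, (inner ℝ y (π k ξ)) ^ m ∂(probHaar K)) / m.factorial =
      ∑ α ∈ Finset.univ.piAntidiag m, (∏ i, ((α i).factorial : ℝ))⁻¹ * (∏ i, y i ^ α i) *
        MvPolynomial.eval (fun i => ξ i) (averagedMonomial π α) := by
    intro y
    simp only [eval_averagedMonomial π hπ]
    rw [← integral_div]
    have h2 : ∀ k, (inner ℝ y (π k ξ)) ^ m / (m.factorial : ℝ) =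
        ∑ α ∈ Finset.univ.piAntidiag m, (∏ i, ((α i).factorial : ℝ))⁻¹ * (∏ i, y i ^ α i) *
          ∏ i, (π k ξ i) ^ α i := by
      intro k
      have h3 : inner ℝ y (π k ξ) = ∑ i, y i * π k ξ i := by
        rw [PiLp.inner_apply]
        exact Finset.sum_congr rfl fun i _ => by simp [mul_comm]
      rw [h3, sum_pow_div_factorial]
      refine Finset.sum_congr rfl fun α _ => ?_
      simp only [mul_pow, Finset.prod_mul_distrib]
      ring
    simp only [h2]
    rw [integral_finsetSum _ fun α _ =>
      ((hcont ξ α).integrable_probHaar).const_mul _]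
    simp only [integral_const_mul]
  have h4 : (∫ k, (inner ℝ x (π k ξ)) ^ m ∂(probHaar K)) / m.factorial =
      ∫ h, (∫ k, (inner ℝ (π h x) (π k ξ)) ^ m ∂(probHaar K)) / m.factorial ∂(probHaar K) := by
    simp [integral_inner_apply_left π]
  rw [h4]
  simp only [h1]
  rw [integral_finsetSum _ fun α _ =>
    (((hcont x α).integrable_probHaar).const_mul _).mul_const _]
  simp only [integral_const_mul, integral_mul_const, eval_averagedMonomial π hπ]

end TaylorExpansion

/-! ### Existence of the expansion -/

section Existence

lemma norm_monomialAt {ℓ : ℕ} (J : Fin ℓ →₀ ℕ) (t : Fin ℓ → ℝ) :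
    ‖monomialAt J t‖ = monomialWeight (fun j => |t j|) J := by
  rw [monomialAt, monomialWeight, Finsupp.prod_fintype _ _ (by simp), norm_prod]
  simp

lemma abs_eval_le_weightedNorm {ℓ : ℕ} {R : ℝ} {s : Fin ℓ → ℝ}
    (hs : ∀ j, |s j| ≤ R) (F : MvPolynomial (Fin ℓ) ℝ) :
    |MvPolynomial.eval s F| ≤ weightedNorm (fun _ => R) F := by
  rw [MvPolynomial.eval_eq']
  refine (Finset.abs_sum_le_sum_abs _ _).trans (Finset.sum_le_sum fun J _ => ?_)
  rw [abs_mul, Finset.abs_prod]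
  refine mul_le_mul_of_nonneg_left ?_ (abs_nonneg _)
  rw [monomialWeight, Finsupp.prod_fintype _ _ (by simp)]
  refine Finset.prod_le_prod (fun _ _ => abs_nonneg _) fun j _ => ?_
  rw [abs_pow]
  exact pow_le_pow_left₀ (abs_nonneg _) (hs j) _

lemma continuous_polyMap {n ℓ : ℕ} (ρ : Fin ℓ → MvPolynomial (Fin n) ℝ) :
    Continuous (polyMap ρ) :=
  continuous_pi fun j => (MvPolynomial.continuous_eval (ρ j)).comp (by fun_prop)

lemma exists_abs_polyMap_le {n ℓ : ℕ} (ρ : Fin ℓ → MvPolynomial (Fin n) ℝ)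
    {s : Set (EuclideanSpace ℝ (Fin n))} (hs : IsCompact s) :
    ∃ R : ℝ, 0 ≤ R ∧ ∀ x ∈ s, ∀ j, |polyMap ρ x j| ≤ R := by
  obtain ⟨R, hR⟩ := hs.exists_bound_of_continuousOn (continuous_polyMap ρ).continuousOn
  exact ⟨max R 0, le_max_right _ _, fun x hx j =>
    ((norm_le_pi_norm (polyMap ρ x) j).trans (hR x hx)).trans (le_max_left _ _)⟩

/-- The coefficients of the expansion built from lifts `F α` of the averaged monomials. -/
noncomputable def expansionCoeff {n ℓ : ℕ} (F : (Fin n → ℕ) → MvPolynomial (Fin ℓ) ℝ) (m : ℕ) :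
    (Fin ℓ →₀ ℕ) →₀ MvPolynomial (Fin ℓ) ℂ :=
  Finsupp.onFinset ((Finset.univ.piAntidiag m).biUnion fun α => (F α).support)
    (fun J => ∑ α ∈ Finset.univ.piAntidiag m,
      MvPolynomial.C (Complex.I ^ m *
        (((∏ i, ((α i).factorial : ℝ))⁻¹ * (F α).coeff J : ℝ) : ℂ)) *
        MvPolynomial.map Complex.ofRealHom (F α))
    fun J hJ => by
      obtain ⟨α, hα, h⟩ := Finset.exists_ne_zero_of_sum_ne_zero hJ
      refine Finset.mem_biUnion.mpr ⟨α, hα, MvPolynomial.mem_support_iff.mpr fun h0 => h ?_⟩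
      simp [h0]

lemma evalReal_map {ℓ : ℕ} (F : MvPolynomial (Fin ℓ) ℝ) (s : Fin ℓ → ℝ) :
    MvPolynomial.eval (fun j => ((s j : ℝ) : ℂ)) (MvPolynomial.map Complex.ofRealHom F) =
      ((MvPolynomial.eval s F : ℝ) : ℂ) := by
  rw [MvPolynomial.eval_map]
  exact (MvPolynomial.eval₂_comp_left Complex.ofRealHom (RingHom.id ℝ) s F).symm

lemma evalReal_expansionCoeff {n ℓ : ℕ} (F : (Fin n → ℕ) → MvPolynomial (Fin ℓ) ℝ) (m : ℕ)
    (J : Fin ℓ →₀ ℕ) (s : Fin ℓ → ℝ) :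
    evalReal (expansionCoeff F m J) s = Complex.I ^ m *
      ((∑ α ∈ Finset.univ.piAntidiag m, (∏ i, ((α i).factorial : ℝ))⁻¹ * (F α).coeff J *
        MvPolynomial.eval s (F α) : ℝ) : ℂ) := by
  simp only [evalReal, expansionCoeff, Finsupp.onFinset_apply, map_sum, map_mul,
    MvPolynomial.eval_C, evalReal_map]
  push_cast
  rw [Finset.mul_sum]
  refine Finset.sum_congr rfl fun α _ => ?_
  ring

lemma ofReal_monomial {ℓ : ℕ} (J : Fin ℓ →₀ ℕ) (t : Fin ℓ → ℝ) :
    monomialAt J t = ((∏ j, t j ^ J j : ℝ) : ℂ) := by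
  simp [monomialAt]

lemma expansionCoeff_sum {n ℓ : ℕ} (F : (Fin n → ℕ) → MvPolynomial (Fin ℓ) ℝ) (m : ℕ)
    (s t : Fin ℓ → ℝ) :
    ((expansionCoeff F m).sum fun J c => evalReal c s * monomialAt J t) = Complex.I ^ m *
      ((∑ α ∈ Finset.univ.piAntidiag m, (∏ i, ((α i).factorial : ℝ))⁻¹ *
        MvPolynomial.eval t (F α) * MvPolynomial.eval s (F α) : ℝ) : ℂ) := by
  classical
  have hsub : (expansionCoeff F m).support ⊆
      (Finset.univ.piAntidiag m).biUnion fun α => (F α).support := Finsupp.support_onFinset_subset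
  rw [Finsupp.sum_of_support_subset _ hsub _ (by simp [evalReal])]
  simp only [evalReal_expansionCoeff, ofReal_monomial, mul_assoc, ← Complex.ofReal_mul]
  rw [← Finset.mul_sum, ← Complex.ofReal_sum]
  congr 2
  simp only [Finset.sum_mul]
  rw [Finset.sum_comm]
  refine Finset.sum_congr rfl fun α hα => ?_
  have ht : MvPolynomial.eval t (F α) =
      ∑ J ∈ (Finset.univ.piAntidiag m).biUnion fun α => (F α).support,
        (F α).coeff J * ∏ j, t j ^ J j := by
    rw [MvPolynomial.eval_eq']
    refine Finset.sum_subset (Finset.subset_biUnion_of_mem (fun α => (F α).support) hα)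
      fun J _ hJ => ?_
    rw [MvPolynomial.notMem_support_iff.mp hJ, zero_mul]
  rw [ht, Finset.sum_mul, Finset.mul_sum]
  exact Finset.sum_congr rfl fun J _ => by ring

/-- The norm of `F α` enters twice, through the sum over `J` and through its value at `s`. The terms
of degree `m` therefore sum to at most `∑ D^(2m) / α! = (n D²)^m / m!`. -/
lemma exists_summable_bound_expansionCoeff {n ℓ : ℕ} (F : (Fin n → ℕ) → MvPolynomial (Fin ℓ) ℝ)
    {R D : ℝ} (hR : 0 ≤ R) (hF : ∀ α, weightedNorm (fun _ => R) (F α) ≤ D ^ ∑ i, α i) :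
    ∃ u : ℕ × (Fin ℓ →₀ ℕ) → ℝ, Summable u ∧ ∀ p (s t : Fin ℓ → ℝ), (∀ j, |s j| ≤ R) →
      (∀ j, |t j| ≤ R) → ‖evalReal (expansionCoeff F p.1 p.2) s * monomialAt p.2 t‖ ≤ u p := by
  classical
  have hR0 : ∀ _ : Fin ℓ, 0 ≤ R := fun _ => hR
  have hmw : ∀ J : Fin ℓ →₀ ℕ, 0 ≤ monomialWeight (fun _ => R) J := monomialWeight_nonneg hR0
  have hwn : ∀ p : MvPolynomial (Fin ℓ) ℝ, 0 ≤ weightedNorm (fun _ => R) p :=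
    weightedNorm_nonneg hR0
  set u : ℕ × (Fin ℓ →₀ ℕ) → ℝ := fun p => ∑ α ∈ Finset.univ.piAntidiag p.1,
    (∏ i, ((α i).factorial : ℝ))⁻¹ * (|(F α).coeff p.2| * monomialWeight (fun _ => R) p.2) *
      weightedNorm (fun _ => R) (F α) with hu
  have hterm : ∀ (α : Fin n → ℕ) (J : Fin ℓ →₀ ℕ), 0 ≤ (∏ i, ((α i).factorial : ℝ))⁻¹ *
      (|(F α).coeff J| * monomialWeight (fun _ => R) J) * weightedNorm (fun _ => R) (F α) :=
    fun α J => mul_nonneg (mul_nonneg (by positivity) (mul_nonneg (abs_nonneg _) (hmw J))) (hwn _)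
  have hu0 : 0 ≤ u := fun p => Finset.sum_nonneg fun α _ => hterm α p.2
  refine ⟨u, ?_, ?_⟩
  · have hzero : ∀ m, ∀ J ∉ (Finset.univ.piAntidiag m).biUnion fun α => (F α).support,
        u (m, J) = 0 := fun m J hJ => Finset.sum_eq_zero fun α hα => by
      have : (F α).coeff J = 0 := MvPolynomial.notMem_support_iff.mp fun h =>
        hJ (Finset.mem_biUnion.mpr ⟨α, hα, h⟩)
      simp [this]
    rw [summable_prod_of_nonneg hu0]
    refine ⟨fun m => summable_of_ne_finset_zero (hzero m), ?_⟩
    refine Summable.of_nonneg_of_le (fun m => tsum_nonneg fun J => hu0 _) (fun m => ?_)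
      (Real.summable_pow_div_factorial (∑ _i : Fin n, D ^ 2))
    rw [tsum_eq_sum (hzero m), sum_pow_div_factorial]
    simp only [hu]
    rw [Finset.sum_comm]
    refine Finset.sum_le_sum fun α hα => ?_
    rw [← Finset.sum_mul, ← Finset.mul_sum, ← weightedNorm_eq_sum (F α)
      (Finset.subset_biUnion_of_mem (fun α => (F α).support) hα), Finset.prod_pow_eq_pow_sum,
      ← pow_mul, mul_comm 2, pow_mul, sq, div_eq_inv_mul, mul_assoc]
    have := hF α
    have this' := hwn (F α)
    exact mul_le_mul_of_nonneg_left 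
      (mul_le_mul this this this' (this'.trans this)) (by positivity)
  · intro p s t hs ht
    rw [norm_mul, evalReal_expansionCoeff, norm_mul, norm_pow, Complex.norm_I, one_pow, one_mul,
      Complex.norm_real, Real.norm_eq_abs, norm_monomialAt]
    have h1 : monomialWeight (fun j => |t j|) p.2 ≤ monomialWeight (fun _ => R) p.2 :=
      monomialWeight_mono (fun _ => abs_nonneg _) ht _
    refine (mul_le_mul (Finset.abs_sum_le_sum_abs _ _) h1
      (monomialWeight_nonneg (fun _ => abs_nonneg _) _)
      (Finset.sum_nonneg fun _ _ => abs_nonneg _)).trans ?_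
    rw [Finset.sum_mul]
    refine Finset.sum_le_sum fun α _ => ?_
    rw [abs_mul, abs_mul, abs_of_nonneg (by positivity : 0 ≤ (∏ i, ((α i).factorial : ℝ))⁻¹)]
    calc _ = (∏ i, ((α i).factorial : ℝ))⁻¹ * (|(F α).coeff p.2| *
          monomialWeight (fun _ => R) p.2) * |MvPolynomial.eval s (F α)| := by ring
      _ ≤ _ := mul_le_mul_of_nonneg_left (abs_eval_le_weightedNorm hs _)
          (mul_nonneg (by positivity) (mul_nonneg (abs_nonneg _) (hmw _)))

theorem exists_isSphericalExpansion {n ℓ : ℕ} {K : Type*} [Group K] [TopologicalSpace K]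
    [IsTopologicalGroup K] [CompactSpace K] [MeasurableSpace K] [BorelSpace K]
    (π : K →* (EuclideanSpace ℝ (Fin n) ≃ₗᵢ[ℝ] EuclideanSpace ℝ (Fin n)))
    (hπ : Continuous fun p : K × EuclideanSpace ℝ (Fin n) => π p.1 p.2)
    (ρ : Fin ℓ → MvPolynomial (Fin n) ℝ)
    (hρ : Algebra.adjoin ℝ (Set.range ρ) = invariantPolynomials π) :
    ∃ q : ℕ → (Fin ℓ →₀ ℕ) →₀ MvPolynomial (Fin ℓ) ℂ, IsSphericalExpansion π ρ q := by
  classical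
  obtain ⟨F, hF1, hF2, hF3⟩ := exists_lift_averagedMonomial π hπ ρ hρ
  have hev : ∀ α (x : EuclideanSpace ℝ (Fin n)), MvPolynomial.eval (polyMap ρ x) (F α) =
      MvPolynomial.eval (fun i => x i) (averagedMonomial π α) := by
    intro α x
    rw [← hF1 α, MvPolynomial.aeval_def, MvPolynomial.algebraMap_eq,
      MvPolynomial.eval_eval₂]
    have hid : (MvPolynomial.eval fun i => x i).comp MvPolynomial.C = RingHom.id ℝ := by
      ext; simp
    rw [hid]
    rfl
  refine ⟨expansionCoeff F, ?_, ?_, ?_, ?_⟩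
  · intro m ξ x
    rw [taylorComponent_sphericalFunction π hπ, integral_inner_pow_div_factorial π hπ,
      expansionCoeff_sum]
    simp only [hev]
  · intro hhom m J hJ
    obtain ⟨α, hα, hJα⟩ := Finset.mem_biUnion.mp (Finsupp.support_onFinset_subset hJ)
    rw [hF3 hhom α J hJα]
    exact (Finset.mem_piAntidiag.mp hα).1
  · intro ξ
    refine SummableLocallyUniformlyOn_of_locally_bounded isOpen_univ fun s _ hs => ?_
    -- Adding the fixed point to the compact set lets one `R` bound both arguments.
    obtain ⟨R, hR, hRs⟩ := exists_abs_polyMap_le ρ (hs.insert ξ)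
    obtain ⟨D, -, hD⟩ := hF2 R hR
    obtain ⟨u, hu, hub⟩ := exists_summable_bound_expansionCoeff F hR hD
    refine ⟨u, hu, fun p x hx => ?_⟩
    rw [norm_norm]
    exact hub p _ _ (hRs ξ (Set.mem_insert _ _)) (hRs x (Set.mem_insert_of_mem _ hx))
  · intro x
    refine SummableLocallyUniformlyOn_of_locally_bounded isOpen_univ fun s _ hs => ?_
    obtain ⟨R, hR, hRs⟩ := exists_abs_polyMap_le ρ (hs.insert x)
    obtain ⟨D, -, hD⟩ := hF2 R hR
    obtain ⟨u, hu, hub⟩ := exists_summable_bound_expansionCoeff F hR hD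
    refine ⟨u, hu, fun p ξ hξ => ?_⟩
    rw [norm_norm]
    exact hub p _ _ (hRs ξ (Set.mem_insert_of_mem _ hξ)) (hRs x (Set.mem_insert _ _))

end Existence

/-! ### Everywhere convergent power series -/

section PowerSeries

/-- List the variables of the monomial with multiplicity, and let the `a`-th slot of the product
read off the `a`-th listed coordinate. -/
lemma exists_multilinear_eq_monomialAt {ℓ : ℕ} (J : Fin ℓ →₀ ℕ) (N : ℕ) (h : J.degree = N) :
    ∃ M : ContinuousMultilinearMap ℝ (fun _ : Fin N => Fin ℓ → ℝ) ℂ, ‖M‖ ≤ 1 ∧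
      ∀ t, M (fun _ => t) = monomialAt J t := by
  classical
  have hlen : (Finsupp.toMultiset J).toList.length = N := by
    rw [Multiset.length_toList, Finsupp.card_toMultiset, ← h, Finsupp.degree_eq_sum,
      Finsupp.sum_fintype _ _ (by simp)]
    rfl
  set l := (Finsupp.toMultiset J).toList with hl
  subst hlen
  refine ⟨(ContinuousMultilinearMap.mkPiAlgebra ℝ (Fin l.length) ℂ).compContinuousLinearMap
    fun a => Complex.ofRealCLM.comp (ContinuousLinearMap.proj (l.get a)), ?_, fun t => ?_⟩
  · refine ContinuousMultilinearMap.opNorm_le_bound zero_le_one fun v => ?_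
    simp only [ContinuousMultilinearMap.compContinuousLinearMap_apply,
      ContinuousMultilinearMap.mkPiAlgebra_apply, one_mul, norm_prod]
    refine Finset.prod_le_prod (fun _ _ => norm_nonneg _) fun a _ => ?_
    simpa using norm_le_pi_norm (v a) (l.get a)
  · simp only [ContinuousMultilinearMap.compContinuousLinearMap_apply,
      ContinuousMultilinearMap.mkPiAlgebra_apply, ContinuousLinearMap.comp_apply,
      ContinuousLinearMap.proj_apply, Complex.ofRealCLM_apply]
    have h1 : ∏ a : Fin l.length, ((t (l.get a) : ℝ) : ℂ) =
        (l.map fun j => ((t j : ℝ) : ℂ)).prod := by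
      rw [← List.prod_ofFn]
      congr 1
      rw [← congrArg (List.map fun j => ((t j : ℝ) : ℂ)) (List.ofFn_get l), List.map_ofFn]
      rfl
    rw [h1, ← Multiset.prod_coe, ← Multiset.map_coe, hl, Multiset.coe_toList,
      Finset.prod_multiset_map_count, monomialAt]
    refine Finset.prod_subset_one_on_sdiff (Finset.subset_univ _) (fun j hj => ?_) fun j _ => by
      rw [Finsupp.count_toMultiset]
    have hj0 : J j = 0 := by simpa using hj
    rw [hj0, pow_zero]

/-- A multivariate power series which converges absolutely everywhere is real analytic. -/
theorem analyticOnNhd_tsum_monomialAt {ℓ : ℕ} {ι : Type*} (c : ι → ℂ) (J : ι → Fin ℓ →₀ ℕ)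
    (hs : ∀ t, Summable fun i => c i * monomialAt (J i) t) :
    AnalyticOnNhd ℝ (fun t => ∑' i, c i * monomialAt (J i) t) Set.univ := by
  classical
  choose M hM1 hM2 using exists_multilinear_eq_monomialAt (ℓ := ℓ)
  -- Evaluation at the constant vector `r` bounds the series on the whole sup-norm ball of radius
  -- `r`.
  have hr : ∀ r : NNReal, Summable fun i => ‖c i‖ * (r : ℝ) ^ (J i).degree := fun r => by
    have h := (hs fun _ => (r : ℝ)).norm
    simpa [norm_monomialAt, monomialWeight_const] using h
  have hc : Summable fun i => ‖c i‖ := by simpa using hr 1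
  set deg : ι → ℕ := fun i => (J i).degree with hdeg
  set p : FormalMultilinearSeries ℝ (Fin ℓ → ℝ) ℂ := fun N =>
    ∑' i : deg ⁻¹' {N}, c i • M (J i) N i.2 with hp
  have hbound : ∀ N (i : deg ⁻¹' {N}), ‖c i • M (J i) N i.2‖ ≤ ‖c i‖ := fun N i => by
    rw [norm_smul]
    exact mul_le_of_le_one_right (norm_nonneg _) (hM1 _ _ _)
  have hsum : ∀ N, Summable fun i : deg ⁻¹' {N} => c i • M (J i) N i.2 := fun N =>
    Summable.of_norm_bounded (hc.subtype _) (hbound N)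
  have hball : HasFPowerSeriesOnBall (fun t => ∑' i, c i * monomialAt (J i) t) p 0 ⊤ := by
    refine ⟨?_, by simp, fun {y} _ => ?_⟩
    · rw [top_le_iff]
      refine ENNReal.eq_top_of_forall_nnreal_le fun r =>
        p.le_radius_of_bound (∑' i, ‖c i‖ * (r : ℝ) ^ (J i).degree) fun N => ?_
      have h1 : ‖p N‖ ≤ ∑' i : deg ⁻¹' {N}, ‖c i‖ :=
        tsum_of_norm_bounded (hc.subtype _).hasSum (hbound N)
      calc ‖p N‖ * (r : ℝ) ^ N ≤ (∑' i : deg ⁻¹' {N}, ‖c i‖) * (r : ℝ) ^ N := by gcongr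
        _ = ∑' i : deg ⁻¹' {N}, ‖c i‖ * (r : ℝ) ^ (J i).degree := by
            rw [← tsum_mul_right]
            refine tsum_congr fun i => ?_
            rw [show (J i).degree = N from i.2]
        _ ≤ ∑' i, ‖c i‖ * (r : ℝ) ^ (J i).degree :=
            (hr r).tsum_subtype_le _ _ fun i => by positivity
    · rw [zero_add]
      have h := (hs y).hasSum.tsum_fiberwise deg
      convert h using 2 with N
      have h2 := (ContinuousMultilinearMap.apply ℝ (fun _ : Fin N => Fin ℓ → ℝ) ℂ
        (fun _ => y)).map_tsum (hsum N)
      simp only [ContinuousMultilinearMap.apply_apply] at h2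
      rw [hp, h2]
      exact tsum_congr fun i => congrArg (c i * ·) (hM2 (J i) N i.2 y)
  have h := hball.analyticOnNhd
  simpa using h

end PowerSeries

/-! ### Dominating a point by values of the generators -/

section Domination

/-- The product of the nonzero polynomials `ρ_j - ρ_j(0)` is nonzero at some `v`. On the line
through `v` every `ρ_j` is then a nonconstant polynomial in one variable, so all `|ρ_j|` become
large together. -/
lemma exists_forall_le_abs_polyMap {n ℓ : ℕ} (ρ : Fin ℓ → MvPolynomial (Fin n) ℝ)
    (hρ : ∀ j, 0 < (ρ j).totalDegree) (T : ℝ) :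
    ∃ x : EuclideanSpace ℝ (Fin n), ∀ j, T ≤ |polyMap ρ x j| := by
  classical
  have hne : ∏ j, (ρ j - MvPolynomial.C (MvPolynomial.eval 0 (ρ j))) ≠ 0 := by
    refine Finset.prod_ne_zero_iff.mpr fun j _ h => ?_
    have := hρ j
    rw [sub_eq_zero.mp h, MvPolynomial.totalDegree_C] at this
    exact lt_irrefl _ this
  obtain ⟨v, hv⟩ : ∃ v : Fin n → ℝ,
      MvPolynomial.eval v (∏ j, (ρ j - MvPolynomial.C (MvPolynomial.eval 0 (ρ j)))) ≠ 0 := by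
    by_contra hcon
    push Not at hcon
    exact hne (MvPolynomial.funext fun v => by simpa using hcon v)
  rw [map_prod] at hv
  set P : Fin ℓ → Polynomial ℝ := fun j =>
    MvPolynomial.aeval (fun i => Polynomial.C (v i) * Polynomial.X) (ρ j) with hP
  have hPeval : ∀ j s, (P j).eval s = MvPolynomial.eval (fun i => v i * s) (ρ j) := by
    intro j s
    have h : (Polynomial.aeval s) (P j) = MvPolynomial.aeval (fun i => v i * s) (ρ j) := by
      rw [hP, ← AlgHom.comp_apply, MvPolynomial.comp_aeval]
      simp
    simpa [MvPolynomial.aeval_eq_eval, Polynomial.coe_aeval_eq_eval] using h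
  have hdeg : ∀ j, 0 < (P j).degree := by
    intro j
    by_contra hcon
    rw [not_lt] at hcon
    have h := Polynomial.eq_C_of_degree_le_zero hcon
    have h01 : (P j).eval 1 = (P j).eval 0 := by rw [h]; simp
    rw [hPeval, hPeval] at h01
    refine Finset.prod_ne_zero_iff.mp hv j (Finset.mem_univ j) ?_
    simp only [mul_one, mul_zero] at h01
    simp only [map_sub, MvPolynomial.eval_C]
    exact sub_eq_zero.mpr h01
  have hev : ∀ᶠ s in Filter.atTop, ∀ j, T ≤ |(P j).eval s| :=
    Filter.eventually_all.mpr fun j =>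
      ((P j).abs_tendsto_atTop (hdeg j)).eventually_ge_atTop T
  obtain ⟨s, hs⟩ := hev.exists
  refine ⟨WithLp.toLp 2 fun i => v i * s, fun j => ?_⟩
  have := hs j
  rw [hPeval] at this
  exact this

lemma norm_monomialAt_le {ℓ : ℕ} {s t : Fin ℓ → ℝ} (h : ∀ j, |s j| ≤ |t j|) (J : Fin ℓ →₀ ℕ) :
    ‖monomialAt J s‖ ≤ ‖monomialAt J t‖ := by
  rw [norm_monomialAt, norm_monomialAt]
  exact monomialWeight_mono (fun _ => abs_nonneg _) h J

lemma exists_forall_norm_monomialAt_le {n ℓ : ℕ} {ρ : Fin ℓ → MvPolynomial (Fin n) ℝ}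
    (hρ : ∀ j, 0 < (ρ j).totalDegree) (t : Fin ℓ → ℝ) :
    ∃ x : EuclideanSpace ℝ (Fin n), ∀ J, ‖monomialAt J t‖ ≤ ‖monomialAt J (polyMap ρ x)‖ := by
  obtain ⟨x, hx⟩ := exists_forall_le_abs_polyMap ρ hρ ‖t‖
  exact ⟨x, norm_monomialAt_le fun j => (norm_le_pi_norm t j).trans (hx j)⟩

end Domination

/-! ### Consequences for an arbitrary expansion -/

section Expansion

variable {n ℓ : ℕ} {K : Type*} [Group K] [TopologicalSpace K]
    [IsTopologicalGroup K] [CompactSpace K] [MeasurableSpace K] [BorelSpace K]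
    {π : K →* (EuclideanSpace ℝ (Fin n) ≃ₗᵢ[ℝ] EuclideanSpace ℝ (Fin n))}
    {ρ : Fin ℓ → MvPolynomial (Fin n) ℝ}
    {q : ℕ → (Fin ℓ →₀ ℕ) →₀ MvPolynomial (Fin ℓ) ℂ}

lemma IsSphericalExpansion.summable (hq : IsSphericalExpansion π ρ q)
    (hρ : ∀ j, 0 < (ρ j).totalDegree) (ξ : EuclideanSpace ℝ (Fin n)) (t : Fin ℓ → ℝ) :
    Summable fun p : ℕ × (Fin ℓ →₀ ℕ) =>
      evalReal (q p.1 p.2) (polyMap ρ ξ) * monomialAt p.2 t := by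
  obtain ⟨x, hx⟩ := exists_forall_norm_monomialAt_le hρ t
  refine Summable.of_norm_bounded ((hq.summable_left ξ).summable (Set.mem_univ x)) fun p => ?_
  rw [norm_mul, norm_mul]
  exact mul_le_mul_of_nonneg_left (hx p.2) (norm_nonneg _)

lemma IsSphericalExpansion.analyticOnNhd_hXi (hq : IsSphericalExpansion π ρ q)
    (hρ : ∀ j, 0 < (ρ j).totalDegree) (ξ : EuclideanSpace ℝ (Fin n)) :
    AnalyticOnNhd ℝ (hXi ρ q ξ) Set.univ :=
  analyticOnNhd_tsum_monomialAt _ _ (hq.summable hρ ξ)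

lemma IsSphericalExpansion.sphericalFunction_eq (hq : IsSphericalExpansion π ρ q)
    (hπ : Continuous fun p : K × EuclideanSpace ℝ (Fin n) => π p.1 p.2)
    (hρ : ∀ j, 0 < (ρ j).totalDegree) (ξ x : EuclideanSpace ℝ (Fin n)) :
    sphericalFunction π ξ x = hXi ρ q ξ (polyMap ρ x) := by
  rw [hXi, (hq.summable hρ ξ _).tsum_prod,
    ← (hasSum_taylorComponent_sphericalFunction π hπ ξ x).tsum_eq]
  refine tsum_congr fun m => ?_
  rw [hq.taylor_eq, Finsupp.sum, tsum_eq_sum fun J hJ => ?_]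
  rw [Finsupp.notMem_support_iff.mp hJ]
  simp [evalReal]

lemma continuous_evalReal_polyMap (ρ : Fin ℓ → MvPolynomial (Fin n) ℝ)
    (c : MvPolynomial (Fin ℓ) ℂ) : Continuous fun ξ => evalReal c (polyMap ρ ξ) :=
  (MvPolynomial.continuous_eval c).comp
    (continuous_pi fun j => Complex.continuous_ofReal.comp
      ((continuous_apply j).comp (continuous_polyMap ρ)))

/-- Supplies the majorant for integration in `ξ`: a locally uniform limit of continuous functions is
continuous, hence integrable against a compactly supported continuous function. -/
lemma IsSphericalExpansion.continuous_tsum_norm (hq : IsSphericalExpansion π ρ q)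
    (x : EuclideanSpace ℝ (Fin n)) : Continuous fun ξ => ∑' p : ℕ × (Fin ℓ →₀ ℕ),
      ‖evalReal (q p.1 p.2) (polyMap ρ ξ) * monomialAt p.2 (polyMap ρ x)‖ := by
  have h := (hq.summable_right x).hasSumLocallyUniformlyOn
  rw [hasSumLocallyUniformlyOn_iff_tendstoLocallyUniformlyOn] at h
  rw [← continuousOn_univ]
  exact h.continuousOn (.of_forall fun s => (continuous_finsetSum _ fun p _ =>
    ((continuous_evalReal_polyMap ρ _).mul continuous_const).norm).continuousOn)

variable {g : EuclideanSpace ℝ (Fin n) → ℂ}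

/-- With `x` chosen so that `ρ(x)` dominates `t`, the function `|g(-ξ)|` times the sum of absolute
values at `ρ(x)` is an integrable majorant for all partial sums, so sum and integral may be
exchanged. -/
lemma IsSphericalExpansion.integrable_and_hasSum (hq : IsSphericalExpansion π ρ q)
    (hρ : ∀ j, 0 < (ρ j).totalDegree) (hg : Continuous g) (hgc : HasCompactSupport g)
    (t : Fin ℓ → ℝ) :
    (Integrable fun ξ => g (-ξ) * hXi ρ q ξ t) ∧
    HasSum (fun p : ℕ × (Fin ℓ →₀ ℕ) =>
      (∫ ξ, g (-ξ) * evalReal (q p.1 p.2) (polyMap ρ ξ)) * monomialAt p.2 t) (hExt ρ q g t) := by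
  obtain ⟨x, hx⟩ := exists_forall_norm_monomialAt_le hρ t
  have hg' : Continuous fun ξ => g (-ξ) := hg.comp continuous_neg
  have hgc' : HasCompactSupport fun ξ => g (-ξ) :=
    hgc.comp_homeomorph (Homeomorph.neg (EuclideanSpace ℝ (Fin n)))
  set f : ℕ × (Fin ℓ →₀ ℕ) → EuclideanSpace ℝ (Fin n) → ℂ := fun p ξ =>
    g (-ξ) * (evalReal (q p.1 p.2) (polyMap ρ ξ) * monomialAt p.2 t) with hf
  have hfc : ∀ p, Continuous (f p) := fun p =>
    hg'.mul ((continuous_evalReal_polyMap ρ _).mul continuous_const)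
  have hfi : ∀ p, Integrable (f p) := fun p =>
    (hfc p).integrable_of_hasCompactSupport hgc'.mul_right
  set S : EuclideanSpace ℝ (Fin n) → ℝ := fun ξ => ∑' p : ℕ × (Fin ℓ →₀ ℕ),
      ‖evalReal (q p.1 p.2) (polyMap ρ ξ) * monomialAt p.2 (polyMap ρ x)‖ with hS
  have hSi : Integrable fun ξ => ‖g (-ξ)‖ * S ξ :=
    (hg'.norm.mul (hq.continuous_tsum_norm x)).integrable_of_hasCompactSupport
      hgc'.norm.mul_right
  have hle : ∀ ξ (p : ℕ × (Fin ℓ →₀ ℕ)),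
      ‖evalReal (q p.1 p.2) (polyMap ρ ξ) * monomialAt p.2 t‖ ≤
      ‖evalReal (q p.1 p.2) (polyMap ρ ξ) * monomialAt p.2 (polyMap ρ x)‖ := fun ξ p => by
    rw [norm_mul, norm_mul]
    exact mul_le_mul_of_nonneg_left (hx p.2) (norm_nonneg _)
  have hsx : ∀ ξ, Summable fun p : ℕ × (Fin ℓ →₀ ℕ) =>
      ‖evalReal (q p.1 p.2) (polyMap ρ ξ) * monomialAt p.2 (polyMap ρ x)‖ := fun ξ =>
    (hq.summable hρ ξ _).norm
  have hpt : ∀ ξ, HasSum (fun p => f p ξ) (g (-ξ) * hXi ρ q ξ t) := fun ξ =>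
    (hq.summable hρ ξ t).hasSum.mul_left _
  -- At `t` itself no continuity in `ξ` is assumed, so measurability comes from the pointwise limit
  -- of the finite partial sums.
  have hmeas : AEStronglyMeasurable (fun ξ => g (-ξ) * hXi ρ q ξ t) volume :=
    aestronglyMeasurable_of_tendsto_ae Filter.atTop
      (f := fun (s : Finset (ℕ × (Fin ℓ →₀ ℕ))) ξ => ∑ p ∈ s, f p ξ)
      (fun s => (continuous_finsetSum _ fun p _ => hfc p).aestronglyMeasurable)
      (.of_forall fun ξ => hpt ξ)
  have hint : Integrable fun ξ => g (-ξ) * hXi ρ q ξ t := by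
    refine hSi.mono' hmeas (.of_forall fun ξ => ?_)
    rw [norm_mul]
    exact mul_le_mul_of_nonneg_left (tsum_of_norm_bounded (hsx ξ).hasSum (hle ξ)) (norm_nonneg _)
  refine ⟨hint, ?_⟩
  have hsum : Summable fun p => ∫ ξ, ‖f p ξ‖ := by
    refine summable_of_sum_le (c := ∫ ξ, ‖g (-ξ)‖ * S ξ)
      (fun p => integral_nonneg fun ξ => norm_nonneg _) fun s => ?_
    rw [← integral_finsetSum _ fun p _ => (hfi p).norm]
    refine integral_mono (integrable_finsetSum _ fun p _ => (hfi p).norm) hSi fun ξ => ?_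
    simp only [hf, norm_mul (g (-ξ)), ← Finset.mul_sum]
    refine mul_le_mul_of_nonneg_left ?_ (norm_nonneg _)
    exact (Finset.sum_le_sum fun p _ => hle ξ p).trans
      ((hsx ξ).sum_le_tsum s fun p _ => norm_nonneg _)
  have h := hasSum_integral_of_summable_integral_norm hfi hsum
  have h1 : ∀ ξ, ∑' p, f p ξ = g (-ξ) * hXi ρ q ξ t := fun ξ => (hpt ξ).tsum_eq
  simp only [h1] at h
  have h2 : ∀ p : ℕ × (Fin ℓ →₀ ℕ), ∫ ξ, f p ξ =
      (∫ ξ, g (-ξ) * evalReal (q p.1 p.2) (polyMap ρ ξ)) * monomialAt p.2 t := fun p => by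
    rw [← integral_mul_const]
    simp only [hf, mul_assoc]
  simp only [h2] at h
  exact h

lemma IsSphericalExpansion.analyticOnNhd_hExt (hq : IsSphericalExpansion π ρ q)
    (hρ : ∀ j, 0 < (ρ j).totalDegree) (hg : Continuous g) (hgc : HasCompactSupport g) :
    AnalyticOnNhd ℝ (hExt ρ q g) Set.univ := by
  have h := analyticOnNhd_tsum_monomialAt
    (fun p : ℕ × (Fin ℓ →₀ ℕ) => ∫ ξ, g (-ξ) * evalReal (q p.1 p.2) (polyMap ρ ξ))
    (fun p => p.2) fun t => (hq.integrable_and_hasSum hρ hg hgc t).2.summable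
  have heq : hExt ρ q g = fun t => ∑' p : ℕ × (Fin ℓ →₀ ℕ),
      (∫ ξ, g (-ξ) * evalReal (q p.1 p.2) (polyMap ρ ξ)) * monomialAt p.2 t :=
    funext fun t => (hq.integrable_and_hasSum hρ hg hgc t).2.tsum_eq.symm
  rw [heq]
  exact h

end Expansion

/-! ### Gelfand transform and Fourier transform -/

section Fourier

variable {n : ℕ} {K : Type*} [Group K]
    {π : K →* (EuclideanSpace ℝ (Fin n) ≃ₗᵢ[ℝ] EuclideanSpace ℝ (Fin n))}
    {g : EuclideanSpace ℝ (Fin n) → ℂ}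

lemma classicalFourier_apply (hgK : ∀ (k : K) (x : EuclideanSpace ℝ (Fin n)), g (π k x) = g x)
    (k : K) (ξ : EuclideanSpace ℝ (Fin n)) :
    classicalFourier g (π k ξ) = classicalFourier g ξ := by
  rw [classicalFourier, ← (π k).measurePreserving.integral_comp
    (π k).toHomeomorph.measurableEmbedding]
  simp [classicalFourier, hgK]

variable [TopologicalSpace K] [IsTopologicalGroup K] [CompactSpace K] [MeasurableSpace K]
  [BorelSpace K]

lemma integral_mul_integral_exp_swap (hg : Integrable g)
    {a : EuclideanSpace ℝ (Fin n) → K → ℝ} (ha : Continuous (Function.uncurry a)) :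
    ∫ x, g x * ∫ k, Complex.exp (Complex.I * (a x k : ℂ)) ∂(probHaar K) =
      ∫ k, (∫ x, g x * Complex.exp (Complex.I * (a x k : ℂ))) ∂(probHaar K) := by
  simp only [← integral_const_mul]
  refine integral_integral_swap ?_
  have hc : Continuous fun p : EuclideanSpace ℝ (Fin n) × K =>
      Complex.exp (Complex.I * (a p.1 p.2 : ℂ)) :=
    Complex.continuous_exp.comp (continuous_const.mul (Complex.continuous_ofReal.comp ha))
  refine (hg.comp_fst (probHaar K)).mul_bdd (c := 1) hc.aestronglyMeasurable
    (.of_forall fun p => ?_)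
  rw [mul_comm, Complex.norm_exp_ofReal_mul_I]

/-- After Fubini, the inner integral at `k` is the Fourier transform at `kξ`, which does not depend
on `k`. -/
lemma gelfandTransform_sphericalFunction
    (hπ : Continuous fun p : K × EuclideanSpace ℝ (Fin n) => π p.1 p.2) (hg : Integrable g)
    (hgK : ∀ (k : K) (x : EuclideanSpace ℝ (Fin n)), g (π k x) = g x)
    (ξ : EuclideanSpace ℝ (Fin n)) :
    gelfandTransform g (sphericalFunction π ξ) = classicalFourier g ξ := by
  have hc : Continuous (Function.uncurry fun (x : EuclideanSpace ℝ (Fin n)) (k : K) =>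
      (inner ℝ (-x) (π k ξ) : ℝ)) :=
    continuous_fst.neg.inner ((continuous_apply_left π hπ ξ).comp continuous_snd)
  have h := integral_mul_integral_exp_swap (K := K) hg hc
  have h1 : ∀ k : K, ∫ x, g x * Complex.exp (Complex.I * ((inner ℝ (-x) (π k ξ) : ℝ) : ℂ)) =
      classicalFourier g ξ := fun k => by
    rw [← classicalFourier_apply hgK k, classicalFourier]
    simp
  simp only [h1] at h
  simpa [gelfandTransform, sphericalFunction] using h

/-- Here the integration runs over the parameter of the spherical function. The substitutions `η ↦
-η` and `η ↦ kη` reduce each inner integral to the Fourier transform at `ξ`; this gives `h(ρ(ξ))`,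
since `h_η(ρ(ξ)) = φ_η(ξ)`. -/
lemma integral_mul_sphericalFunction
    (hπ : Continuous fun p : K × EuclideanSpace ℝ (Fin n) => π p.1 p.2) (hg : Integrable g)
    (hgK : ∀ (k : K) (x : EuclideanSpace ℝ (Fin n)), g (π k x) = g x)
    (ξ : EuclideanSpace ℝ (Fin n)) :
    ∫ η, g (-η) * sphericalFunction π η ξ = classicalFourier g ξ := by
  have hc : Continuous (Function.uncurry fun (η : EuclideanSpace ℝ (Fin n)) (k : K) =>
      (inner ℝ ξ (π k η) : ℝ)) :=
    continuous_const.inner (hπ.comp (continuous_snd.prodMk continuous_fst))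
  have h := integral_mul_integral_exp_swap (K := K) hg.comp_neg hc
  have h1 : ∀ k : K, ∫ η, g (-η) * Complex.exp (Complex.I * ((inner ℝ ξ (π k η) : ℝ) : ℂ)) =
      classicalFourier g ξ := fun k => by
    rw [← integral_neg_eq_self, classicalFourier,
      ← (π k).measurePreserving.integral_comp (π k).toHomeomorph.measurableEmbedding
        fun η => g η * Complex.exp (-Complex.I * ((inner ℝ η ξ : ℝ) : ℂ))]
    simp [hgK, real_inner_comm]
  simp only [h1] at h
  simpa [sphericalFunction] using h

end Fourier

theorem corollary1p4 {n ℓ : ℕ} {K : Type*} [Group K] [TopologicalSpace K] [IsTopologicalGroup K]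
    [CompactSpace K] [T2Space K] [MeasurableSpace K] [BorelSpace K]
    (π : K →* (EuclideanSpace ℝ (Fin n) ≃ₗᵢ[ℝ] EuclideanSpace ℝ (Fin n)))
    (hπ : Continuous fun p : K × EuclideanSpace ℝ (Fin n) => π p.1 p.2)
    (ρ : Fin ℓ → MvPolynomial (Fin n) ℝ)
    (hρ : Algebra.adjoin ℝ (Set.range ρ) = invariantPolynomials π)
    (hρ_nonconst : ∀ j, 0 < (ρ j).totalDegree) :
    (∃ q : ℕ → (Fin ℓ →₀ ℕ) →₀ MvPolynomial (Fin ℓ) ℂ, IsSphericalExpansion π ρ q) ∧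
    ∀ q : ℕ → (Fin ℓ →₀ ℕ) →₀ MvPolynomial (Fin ℓ) ℂ, IsSphericalExpansion π ρ q →
      (∀ ξ : EuclideanSpace ℝ (Fin n),
        (∀ t : Fin ℓ → ℝ, Summable fun p : ℕ × (Fin ℓ →₀ ℕ) =>
          evalReal (q p.1 p.2) (polyMap ρ ξ) * monomialAt p.2 t) ∧
        AnalyticOnNhd ℝ (hXi ρ q ξ) Set.univ ∧
        ∀ x, sphericalFunction π ξ x = hXi ρ q ξ (polyMap ρ x)) ∧
      ∀ g : EuclideanSpace ℝ (Fin n) → ℂ, ContDiff ℝ ∞ g → HasCompactSupport g →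
        (∀ (k : K) (x : EuclideanSpace ℝ (Fin n)), g (π k x) = g x) →
        (∀ t : Fin ℓ → ℝ, Integrable fun ξ => g (-ξ) * hXi ρ q ξ t) ∧
        ContDiff ℝ ∞ (hExt ρ q g) ∧
        AnalyticOnNhd ℝ (hExt ρ q g) Set.univ ∧
        ∀ ξ : EuclideanSpace ℝ (Fin n),
          gelfandTransform g (sphericalFunction π ξ) = classicalFourier g ξ ∧
          classicalFourier g ξ = hExt ρ q g (polyMap ρ ξ) := by
  refine ⟨exists_isSphericalExpansion π hπ ρ hρ, fun q hq => ⟨fun ξ =>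
    ⟨hq.summable hρ_nonconst ξ, hq.analyticOnNhd_hXi hρ_nonconst ξ,
      hq.sphericalFunction_eq hπ hρ_nonconst ξ⟩, fun g hg hgc hgK => ?_⟩⟩
  have han := hq.analyticOnNhd_hExt hρ_nonconst hg.continuous hgc
  have hgi : Integrable g := hg.continuous.integrable_of_hasCompactSupport hgc
  refine ⟨fun t => (hq.integrable_and_hasSum hρ_nonconst hg.continuous hgc t).1,
    han.contDiff, han, fun ξ => ⟨gelfandTransform_sphericalFunction hπ hgi hgK ξ, ?_⟩⟩
  rw [← integral_mul_sphericalFunction hπ hgi hgK, hExt]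
  simp only [hq.sphericalFunction_eq hπ hρ_nonconst]
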